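/- \textbf{The game.} A \emph{game automaton} is a DFA $D=(\{0,1\},Q,q_0,\delta,F_\exists\cup F_\forall)$ with $Q=\{0,\dots,n-1\}$. A \emph{policy} $P$ is a finite deterministic automaton over a one-letter alphabet, with state set $\Pi$, together with functions $P_{\mathrm{mid}},P_{\mathrm{end}}:\Pi\to\mathbb N\times\mathbb N$. In the \emph{Team DFA Game with Communication} (TDGC) on $(D,P)$ the team $\{\exists_0,\exists_1\}$ plays against $\{\forall\}$. Initially $D$ and the policy are in their start states. A round that starts with $D$ in state $q$ and the policy in state $p$ proceeds as follows. \begin{enumerate} \item If $q\in F_\exists$, the existential team wins; otherwise, if $q\in F_\forall$, the universal team wins. \item $\forall$ learns $q$ and inputs two bits $b_0,b_1$ into $D$; $\exists_i$ learns only $b_i$. \item Mid-round exchange: simultaneously, each $\exists_i$ sends $P_{\mathrm{mid}}(p)[i]$ bits to $\exists_{1-i}$; $\forall$ learns both messages. \item $\exists_0$ inputs a bit $m_0$, then $\exists_1$ inputs a bit $m_1$ into $D$; only $\forall$ learns these moves of the two players. \item End-of-round exchange: simultaneously, each $\exists_i$ sends $P_{\mathrm{end}}(p)[i]$ bits to $\exists_{1-i}$;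 $\forall$ learns both messages. The policy advances to its next state. \end{enumerate} Each choice of a player is a function of what that player has learned so far. If $F_\exists\cup F_\forall$ is never reached, nobody wins. A team has a \emph{forced win} if its players have strategies with which it wins whatever strategies the other team uses. For a fixed policy $P$ and a fixed team, the decision problem $\mathrm{TDGC}_P$ asks, given $D$ (as a table of $\delta$, with states as binary numbers, the start state, and the sets $F_\exists,F_\forall$), whether the team has a forced win on $(D,P)$. EXPSPACE is the class of languages decided by deterministic Turing machines in space $2^{\mathrm{poly}}$ of the input length. \textbf{Theorem.} Let a team (existential or universal) be given. \begin{enumerate} \item[(a)] $\mathrm{TDGC}_P$ is decidable in EXPSPACE for all policies $P$ with a $1$-bit mid-round exchange every round from $\exists_0$ to $\exists_1$, and none from $\exists_1$ to $\exists_0$, that is, with $P_{\mathrm{mid}}(p)=(1,0)$ and $P_{\mathrm{end}}(p)=(0,0)$ for all $p\in\Pi$. Moreover one and the same algorithm, which takes only $D$ as input, works for all these policies. \item[(b)] Let $i\in\{0,1\}$. $\mathrm{TDGC}_P$ is decidable in EXPSPACE for all policies $P$ with at least a $1$-bit mid-round exchange every round from $\exists_i$ to $\exists_{1-i}$, and a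 silent $\exists_{1-i}$, that is, with $P_{\mathrm{mid}}(p)[i]\ge 1$ and $P_{\mathrm{mid}}(p)[1-i]=P_{\mathrm{end}}(p)[1-i]=0$ for all $p\in\Pi$. Moreover, for each $i$, one and the same algorithm, which takes only $D$ as input, works for all these policies. \end{enumerate} -/

import Mathlib

/-! ### The Team DFA Game with Communication -/

/-- A game automaton: a DFA over `{0,1}` whose set of final states is `F_∃ ∪ F_∀`. -/
structure GameDFA (Q : Type) extends DFA Bool Q where
  /-- the final states `F_∃`, winning for the existential team -/
  winE : Finset Q
  /-- the final states `F_∀`, winning for the universal team -/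
  winA : Finset Q
  accept_eq : accept = {q | q ∈ winE ∨ q ∈ winA}

/-- A communication policy: a DFA over a one-letter alphabet, without final states, together with
the numbers `mid p i` and `fin p i` of bits sent by `∃ᵢ` to its teammate in the mid-round and in
the end-of-round exchange of a round that is played in policy state `p`. -/
structure Policy (S : Type) extends DFA Unit S where
  mid : S → Fin 2 → ℕ
  fin : S → Fin 2 → ℕ
  accept_eq : accept = ∅

/-- Everything that happens in one round; index `i` refers to player `∃ᵢ`. -/
structure Round (Q : Type) where
  /-- state of the game automaton at the start of the round -/
  state : Q
  /-- the bits `b₀, b₁` of `∀` -/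
  bit : Fin 2 → Bool
  /-- the mid-round messages; `midMsg i` is sent by `∃ᵢ` -/
  midMsg : Fin 2 → List Bool
  /-- the bits `m₀, m₁` of the existential players -/
  move : Fin 2 → Bool
  /-- the end-of-round messages; `finMsg i` is sent by `∃ᵢ` -/
  finMsg : Fin 2 → List Bool

/-- What an existential player learns in one round: its own bit from `∀`, and the two messages
received from its teammate. -/
structure Obs where
  bit : Bool
  midRecv : List Bool
  finRecv : List Bool

/-- What `∃ᵢ` has learned from the past rounds (as everywhere below, the latest round is first). -/
def view {Q : Type} (i : Fin 2) (past : List (Round Q)) : List Obs :=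
  past.map fun r => ⟨r.bit i, r.midMsg (1 - i), r.finMsg (1 - i)⟩

/-- A strategy of an existential player. Each choice depends on what the player has learned in the
past rounds and so far in the present round. A message consists of as many bits as the policy
allows, which is the number `k` below. (The player's own earlier choices are determined by the
same information, and the number of the round is the length of the list plus one.) -/
structure EStrategy where
  /-- the mid-round message, chosen after learning the own bit -/
  mid : List Obs → Bool → (k : ℕ) → Fin k → Bool
  /-- the move, chosen after learning the own bit and the received mid-round message -/
  move : List Obs → Bool → List Bool → Bool
  /-- the end-of-round message, chosen from the same information as the move -/
  fin : List Obs → Bool → List Bool → (k : ℕ) → Fin k → Bool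

/-- A strategy of the universal player: it chooses `b₀, b₁` knowing the present state and the whole
past, including all moves and all messages. -/
def AStrategy (Q : Type) : Type := Q → List (Round Q) → Fin 2 → Bool

/-- A position at the start of a round. -/
structure Position (Q S : Type) where
  state : Q
  policyState : S
  past : List (Round Q)

/-- The round that is played from a given position. -/
def playRound {Q S : Type} (P : Policy S) (s : Fin 2 → EStrategy) (a : AStrategy Q)
    (x : Position Q S) : Round Q :=
  let b : Fin 2 → Bool := a x.state x.past
  let t : Fin 2 → List Bool := fun i =>
    List.ofFn ((s i).mid (view i x.past) (b i) (P.mid x.policyState i))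
  let m : Fin 2 → Bool := fun i => (s i).move (view i x.past) (b i) (t (1 - i))
  let e : Fin 2 → List Bool := fun i =>
    List.ofFn ((s i).fin (view i x.past) (b i) (t (1 - i)) (P.fin x.policyState i))
  { state := x.state, bit := b, midMsg := t, move := m, finMsg := e }

/-- The position after a given round: `D` has read `b₀, b₁, m₀, m₁` in this order. -/
def advance {Q S : Type} (D : GameDFA Q) (P : Policy S) (x : Position Q S) (r : Round Q) :
    Position Q S where
  state := D.evalFrom x.state [r.bit 0, r.bit 1, r.move 0, r.move 1]
  policyState := P.step x.policyState ()
  past := r :: x.past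

/-- The position at the start of round `k` (counted from zero) when the game is played with given
strategies. The sequence is continued after the end of the game, to no effect. -/
def position {Q S : Type} (D : GameDFA Q) (P : Policy S) (s : Fin 2 → EStrategy)
    (a : AStrategy Q) : ℕ → Position Q S
  | 0 => ⟨D.start, P.start, []⟩
  | k + 1 =>
    let x := position D P s a k
    advance D P x (playRound P s a x)

/-- The two teams `{∃₀, ∃₁}` and `{∀}`. -/
inductive Team
  | existential
  | universal

/-- A team wins a play if it wins at the start of some round before which nobody has won. At the
start of a round `F_∃` is tested before `F_∀`; nobody wins a play that never reaches
`F_∃ ∪ F_∀`. -/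
def Team.Wins {Q S : Type} (D : GameDFA Q) (P : Policy S) (s : Fin 2 → EStrategy)
    (a : AStrategy Q) : Team → Prop
  | .existential => ∃ k, (position D P s a k).state ∈ D.winE ∧
      ∀ j < k, (position D P s a j).state ∉ D.accept
  | .universal => ∃ k, (position D P s a k).state ∉ D.winE ∧
      (position D P s a k).state ∈ D.winA ∧ ∀ j < k, (position D P s a j).state ∉ D.accept

/-- A team has a forced win if its players have strategies with which the team wins whatever
strategies the other team uses. -/
def Team.HasForcedWin {Q S : Type} (D : GameDFA Q) (P : Policy S) : Team → Prop
  | .existential => ∃ s, ∀ a, Team.existential.Wins D P s a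
  | .universal => ∃ a, ∀ s, Team.universal.Wins D P s a

/-! ### The decision problem -/

/-- A list of natural numbers as a word over `{0, 1, #}`: each number is written in binary and
followed by the separator `#`, which is `none`. -/
def encodeNats (l : List ℕ) : List (Option Bool) :=
  l.flatMap fun k => (Computability.encodeNat k).map some ++ [none]

/-- The encoding of a game automaton with states `0, …, n - 1`: the number `n`, the initial state,
the transition table, and the characteristic vectors of `F_∃` and `F_∀`. -/
def encodeGame {n : ℕ} (D : GameDFA (Fin n)) : List (Option Bool) :=
  encodeNats ([n, (D.start : ℕ)]
    ++ (List.finRange n).flatMap (fun q => [(D.step q false : ℕ), (D.step q true : ℕ)])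
    ++ (List.finRange n).map (fun q => if q ∈ D.winE then 1 else 0)
    ++ (List.finRange n).map (fun q => if q ∈ D.winA then 1 else 0))

/-- The decision problem of the Team DFA Game with Communication under the policy `P`: given a game
automaton, does the given team have a forced win? -/
def TDGC (team : Team) {S : Type} (P : Policy S) : Language (Option Bool) :=
  {x | ∃ (n : ℕ) (D : GameDFA (Fin n)), x = encodeGame D ∧ team.HasForcedWin D P}

/-! ### Exponential space -/

/-- The space that a configuration of a multi-stack Turing machine occupies: the total number of
symbols on its stacks. -/
def Turing.FinTM2.cfgSpace (tm : Turing.FinTM2) (c : tm.Cfg) : ℕ :=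
  letI := tm.kFin
  ∑ k, (c.stk k).length

/-- `L` is decided in space `f`: there is a deterministic Turing machine, with all stack alphabets
finite and with the letters of `L` among its input symbols, which on every word `x` halts, accepts
(by its internal state at the halt) exactly if `x ∈ L`, and never occupies more than `f |x|`
cells. -/
def DecidableInSpace {α : Type} (L : Language α) (f : ℕ → ℕ) : Prop :=
  ∃ (tm : Turing.FinTM2) (inp : α ↪ tm.Γ tm.k₀) (acc : Set tm.σ),
    (∀ k, Finite (tm.Γ k)) ∧
    ∀ x : List α,
      (∀ c : tm.Cfg, StateTransition.Reaches tm.step (Turing.initList tm (x.map inp)) c →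
        tm.cfgSpace c ≤ f x.length) ∧
      ∃ c : tm.Cfg, StateTransition.Reaches tm.step (Turing.initList tm (x.map inp)) c ∧
        c.l = none ∧ (c.var ∈ acc ↔ x ∈ L)

/-- The class EXPSPACE, the union over all polynomials `p` of the classes `SPACE(2 ^ p(n))`. -/
def InEXPSPACE {α : Type} (L : Language α) : Prop :=
  ∃ p : Polynomial ℕ, DecidableInSpace L fun n => 2 ^ p.eval n

/-!
Whether a team has a forced win depends, for the policies in question, on the game automaton only.

*Universal team.* The universal player has full information, and against a fixed strategy of that
player the other team can achieve every sequence of moves by playing it blindly. Hence the universal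
team has a forced win exactly if the start state is in the attractor `UWin` of a reachability game
on the states, whatever the policy is (`exists_universal_strategy`, `uWin_of_universal`).

*Existential team.* The sender `∃ᵢ` receives nothing, so it knows its own bits only. One bit per
round suffices to forward its bit, so its teammate can know everything. The game therefore becomes a
game on sets of states: the set `A` of states that are possible for the given bits of `∃ᵢ`. In a
round, `∃ᵢ` chooses its move from its bit, and the teammate leads each state of `A` into the next
set; smaller sets are better, so a choice that depends on the state alone is enough. The
attractor `EWin` of the empty set (all plays are won) characterizes the forced wins: strategies are
read off from the ranks (`existential_of_eWin`), and conversely winning strategies have a finite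
horizon by compactness (`exists_horizon`), which bounds the rank of the sets of states that they
admit (`eWin_of_existential`).

*Complexity.* An attractor is the least set closed under a rule, so membership in it can be tested
by running through all sets of states, or through all families of such sets. A family is a number
below `2 ^ 2 ^ n`, hence has `2 ^ n` binary digits. A stack over the alphabet `{0, 1, #}` is the
same as a number in bijective ternary numeration, so that an input word already is a number `X`, and
`2 ^ X` bounds all families. Functions that are obtained from the basic ones by composition and by
primitive recursion with linear bounds (`Tame`) are computed by stack programs in space linear in
the lengths of the arguments (`Comp.prec`); bounded quantification stays in this class
(`TameP.ball`). The winning condition is such a predicate of `X` and `2 ^ X` (`tameP_tUniversal`,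
`tameP_tExistential`), and hence is decided in exponential space (`inEXPSPACE_of_tameP`). An input
word is matched with all tables of game automata instead of being parsed (`inEXPSPACE_of_table`).
-/

/-! ### Structured programs on stacks -/

namespace StackProg

/-- The common alphabet of all stacks; it is also the input alphabet. -/
abbrev Sym := Option Bool

/-- The contents of the stacks, which are indexed by `ℕ`; a program mentions finitely many. -/
abbrev Store := ℕ → List Sym

/-- Structured programs on stacks; the tests inspect the top symbol of a stack. -/
inductive Prog
  /-- do nothing -/
  | skip
  /-- push a symbol on stack `k` -/
  | push (k : ℕ) (a : Sym)
  /-- remove the top symbol of stack `k`, if there is one -/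
  | pop (k : ℕ)
  | seq (p q : Prog)
  /-- branch on the top symbol of stack `k` -/
  | ite (k : ℕ) (t : Option Sym → Bool) (p q : Prog)
  /-- repeat a program as long as the top symbol of stack `k` passes the test -/
  | loop (k : ℕ) (t : Option Sym → Bool) (p : Prog)

/-- `Run I p s s'`: started in `s`, the program `p` terminates in `s'`, and all stores that occur
on the way satisfy `I`. The predicate `I` serves to bound the space. -/
inductive Run (I : Store → Prop) : Prog → Store → Store → Prop
  | skip {s} : I s → Run I .skip s s
  | push {s k a} : I s → I (Function.update s k (a :: s k)) →
      Run I (.push k a) s (Function.update s k (a :: s k))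
  | pop {s k} : I s → I (Function.update s k (s k).tail) →
      Run I (.pop k) s (Function.update s k (s k).tail)
  | seq {p q s₁ s₂ s₃} : Run I p s₁ s₂ → Run I q s₂ s₃ → Run I (.seq p q) s₁ s₃
  | ite_true {k t p q s s'} : I s → t (s k).head? = true → Run I p s s' →
      Run I (.ite k t p q) s s'
  | ite_false {k t p q s s'} : I s → t (s k).head? = false → Run I q s s' →
      Run I (.ite k t p q) s s'
  | loop_false {k t p s} : I s → t (s k).head? = false → Run I (.loop k t p) s s
  | loop_true {k t p s₁ s₂ s₃} : I s₁ → t (s₁ k).head? = true → Run I p s₁ s₂ →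
      Run I (.loop k t p) s₂ s₃ → Run I (.loop k t p) s₁ s₃

/-- A number above all stacks that a program mentions. -/
def Prog.bound : Prog → ℕ
  | .skip => 0
  | .push k _ => k + 1
  | .pop k => k + 1
  | .seq p q => max p.bound q.bound
  | .ite k _ p q => max (k + 1) (max p.bound q.bound)
  | .loop k _ p => max (k + 1) p.bound

/-- The control points of a program. -/
def Prog.Label : Prog → Type
  | .skip => Unit
  | .push _ _ => Unit
  | .pop _ => Unit
  | .seq p q => p.Label ⊕ q.Label
  | .ite _ _ p q => Option (p.Label ⊕ q.Label)
  | .loop _ _ p => Option p.Label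

instance Prog.finite_label : (p : Prog) → Finite p.Label
  | .skip => inferInstanceAs (Finite Unit)
  | .push _ _ => inferInstanceAs (Finite Unit)
  | .pop _ => inferInstanceAs (Finite Unit)
  | .seq p q =>
    have := p.finite_label
    have := q.finite_label
    inferInstanceAs (Finite (p.Label ⊕ q.Label))
  | .ite _ _ p q =>
    have := p.finite_label
    have := q.finite_label
    inferInstanceAs (Finite (Option (p.Label ⊕ q.Label)))
  | .loop _ _ p =>
    have := p.finite_label
    inferInstanceAs (Finite (Option p.Label))

/-- The control point at which a program starts. -/
def Prog.entry : (p : Prog) → p.Label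
  | .skip => ()
  | .push _ _ => ()
  | .pop _ => ()
  | .seq p _ => Sum.inl p.entry
  | .ite _ _ _ _ => none
  | .loop _ _ _ => none

/-- The statements of a machine with `R + 1` stacks whose state stores one inspected symbol. -/
abbrev MStmt (R : ℕ) (Λ : Type) :=
  Turing.TM2.Stmt (fun _ : Fin (R + 1) => Sym) Λ (Option Sym)

/-- The statement at each control point of a program. The control points of the program are
embedded by `emb` into the labels of the machine, and control is passed to `exit` at the end. -/
def Prog.code (R : ℕ) {Λ : Type} :
    (p : Prog) → (emb : p.Label → Λ) → (exit : Λ) → p.Label → MStmt R Λ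
  | .skip, _, exit, _ => .goto fun _ => exit
  | .push k a, _, exit, _ => .push (Fin.ofNat (R + 1) k) (fun _ => a) (.goto fun _ => exit)
  | .pop k, _, exit, _ => .pop (Fin.ofNat (R + 1) k) (fun v _ => v) (.goto fun _ => exit)
  | .seq p q, emb, exit, l =>
    match l with
    | Sum.inl l => p.code R (fun l => emb (Sum.inl l)) (emb (Sum.inr q.entry)) l
    | Sum.inr l => q.code R (fun l => emb (Sum.inr l)) exit l
  | .ite k t p q, emb, exit, l =>
    match l with
    | none => .peek (Fin.ofNat (R + 1) k) (fun _ a => a) (.branch t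
        (.goto fun _ => emb (some (Sum.inl p.entry)))
        (.goto fun _ => emb (some (Sum.inr q.entry))))
    | some (Sum.inl l) => p.code R (fun l => emb (some (Sum.inl l))) exit l
    | some (Sum.inr l) => q.code R (fun l => emb (some (Sum.inr l))) exit l
  | .loop k t p, emb, exit, l =>
    match l with
    | none => .peek (Fin.ofNat (R + 1) k) (fun _ a => a) (.branch t
        (.goto fun _ => emb (some p.entry)) (.goto fun _ => exit))
    | some l => p.code R (fun l => emb (some l)) (emb none) l

/-! ### Compilation to Turing machines -/

/-- A finite computation all of whose configurations satisfy `I`. -/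
inductive Path {C : Type} (step : C → Option C) (I : C → Prop) : C → C → Prop
  | refl {c} : I c → Path step I c c
  | head {c₁ c₂ c₃} : I c₁ → step c₁ = some c₂ → Path step I c₂ c₃ → Path step I c₁ c₃

namespace Path

variable {C : Type} {step : C → Option C} {I : C → Prop}

theorem trans {a b c : C} (h : Path step I a b) (h' : Path step I b c) : Path step I a c := by
  induction h with
  | refl _ => exact h'
  | head h₁ h₂ _ ih => exact .head h₁ h₂ (ih h')

theorem single {a b : C} (ha : I a) (h : step a = some b) (hb : I b) : Path step I a b :=
  .head ha h (.refl hb)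

theorem reaches {a b : C} (h : Path step I a b) : StateTransition.Reaches step a b := by
  induction h with
  | refl _ => exact .refl
  | head _ h₂ _ ih => exact .head h₂ ih

/-- A deterministic computation cannot leave a path that ends in a halting configuration. -/
theorem of_reaches {a b c : C} (h : Path step I a b) (hb : step b = none)
    (hc : StateTransition.Reaches step a c) : I c := by
  induction h with
  | refl h =>
    rcases Relation.ReflTransGen.cases_head hc with rfl | ⟨d, hd, -⟩
    · exact h
    · simp [hb] at hd
  | head h₁ h₂ _ ih =>
    rcases Relation.ReflTransGen.cases_head hc with rfl | ⟨d, hd, hdc⟩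
    · exact h₁
    · rw [h₂, Option.mem_some_iff] at hd
      subst hd
      exact ih hb hdc

end Path

section Compile

variable {R : ℕ} {Λ : Type} {I : Store → Prop}

/-- The first `R + 1` stacks of a store. -/
def restrict (R : ℕ) (s : Store) : Fin (R + 1) → List Sym := fun k => s k

/-- The machine configuration at the label `l`. -/
def cfg (l : Option Λ) (v : Option Sym) (s : Store) :
    Turing.TM2.Cfg (fun _ : Fin (R + 1) => Sym) Λ (Option Sym) :=
  ⟨l, v, restrict R s⟩

/-- The stacks of the configuration are those of a store that satisfies `I`. -/
def CfgInv (R : ℕ) (I : Store → Prop) (c : Turing.TM2.Cfg (fun _ : Fin (R + 1) => Sym) Λ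
    (Option Sym)) : Prop :=
  ∃ s, I s ∧ c.stk = restrict R s

theorem restrict_apply_ofNat {k : ℕ} (hk : k < R + 1) (s : Store) :
    restrict R s (Fin.ofNat (R + 1) k) = s k := by
  simp [restrict, Nat.mod_eq_of_lt hk]

theorem update_restrict {k : ℕ} (hk : k < R + 1) (s : Store) (l : List Sym) :
    Function.update (restrict R s) (Fin.ofNat (R + 1) k) l
      = restrict R (Function.update s k l) := by
  funext i
  by_cases h : i = Fin.ofNat (R + 1) k
  · subst h
    simp [restrict, Nat.mod_eq_of_lt hk]
  · have : (i : ℕ) ≠ k := by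
      rintro rfl
      exact h (by ext; simp)
    rw [Function.update_of_ne h]
    simp [restrict, Function.update_of_ne this]

theorem step_test {m : Λ → MStmt R Λ} {l l₁ l₂ : Λ} {k : ℕ} {t : Option Sym → Bool}
    (hm : m l = .peek (Fin.ofNat (R + 1) k) (fun _ a => a)
      (.branch t (.goto fun _ => l₁) (.goto fun _ => l₂))) (hk : k < R + 1)
    (v : Option Sym) (s : Store) :
    Turing.TM2.step m (cfg (some l) v s)
      = some (cfg (some (cond (t (s k).head?) l₁ l₂)) (s k).head? s) := by
  simp only [cfg, Turing.TM2.step, hm, Turing.TM2.stepAux, restrict_apply_ofNat hk]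
  cases t (s k).head? <;> rfl

theorem Run.inv_left {p : Prog} {s s' : Store} (h : Run I p s s') : I s := by
  induction h <;> assumption

theorem Run.inv_right {p : Prog} {s s' : Store} (h : Run I p s s') : I s' := by
  induction h <;> assumption

theorem cfgInv_cfg {s : Store} (h : I s) (l : Option Λ) (v : Option Sym) :
    CfgInv R I (cfg l v s) :=
  ⟨s, h, rfl⟩

/-- A machine that contains the code of a program simulates its runs. -/
theorem Run.path {m : Λ → MStmt R Λ} {p : Prog} {s s' : Store} (h : Run I p s s') :
    ∀ (emb : p.Label → Λ) (exit : Λ), p.bound ≤ R + 1 →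
      (∀ l, m (emb l) = p.code R emb exit l) → ∀ v, ∃ v',
        Path (Turing.TM2.step m) (CfgInv R I) (cfg (some (emb p.entry)) v s)
          (cfg (some exit) v' s') := by
  induction h with
  | skip hs =>
    intro emb exit _ hm v
    refine ⟨v, .single (cfgInv_cfg hs _ _) ?_ (cfgInv_cfg hs _ _)⟩
    simp [cfg, hm, Prog.code]
  | @push s k a hs hs' =>
    intro emb exit hb hm v
    refine ⟨v, .single (cfgInv_cfg hs _ _) ?_ (cfgInv_cfg hs' _ _)⟩
    have hk : k < R + 1 := hb
    simp only [cfg, Turing.TM2.step, hm, Prog.code, Turing.TM2.stepAux]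
    rw [restrict_apply_ofNat hk, update_restrict hk]
  | @pop s k hs hs' =>
    intro emb exit hb hm v
    refine ⟨v, .single (cfgInv_cfg hs _ _) ?_ (cfgInv_cfg hs' _ _)⟩
    have hk : k < R + 1 := hb
    simp only [cfg, Turing.TM2.step, hm, Prog.code, Turing.TM2.stepAux]
    rw [restrict_apply_ofNat hk, update_restrict hk]
  | @seq p q s₁ s₂ s₃ _ _ ih₁ ih₂ =>
    intro emb exit hb hm v
    obtain ⟨hb₁, hb₂⟩ := max_le_iff.1 hb
    obtain ⟨v₁, h₁⟩ := ih₁ (fun l => emb (Sum.inl l)) (emb (Sum.inr q.entry)) hb₁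
      (fun l => hm (Sum.inl l)) v
    obtain ⟨v₂, h₂⟩ := ih₂ (fun l => emb (Sum.inr l)) exit hb₂ (fun l => hm (Sum.inr l)) v₁
    exact ⟨v₂, h₁.trans h₂⟩
  | @ite_true k t p q s s' hs ht _ ih =>
    intro emb exit hb hm v
    simp only [Prog.bound, max_le_iff] at hb
    obtain ⟨hk, hb₁, -⟩ := hb
    obtain ⟨v₁, h₁⟩ := ih (fun l => emb (some (Sum.inl l))) exit hb₁
      (fun l => hm (some (Sum.inl l))) (s k).head?
    refine ⟨v₁, .head (cfgInv_cfg hs _ _) ?_ h₁⟩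
    exact (step_test (hm none) hk _ _).trans (by rw [ht]; rfl)
  | @ite_false k t p q s s' hs ht _ ih =>
    intro emb exit hb hm v
    simp only [Prog.bound, max_le_iff] at hb
    obtain ⟨hk, -, hb₁⟩ := hb
    obtain ⟨v₁, h₁⟩ := ih (fun l => emb (some (Sum.inr l))) exit hb₁
      (fun l => hm (some (Sum.inr l))) (s k).head?
    refine ⟨v₁, .head (cfgInv_cfg hs _ _) ?_ h₁⟩
    exact (step_test (hm none) hk _ _).trans (by rw [ht]; rfl)
  | @loop_false k t p s hs ht =>
    intro emb exit hb hm v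
    simp only [Prog.bound, max_le_iff] at hb
    refine ⟨(s k).head?, .single (cfgInv_cfg hs _ _) ?_ (cfgInv_cfg hs _ _)⟩
    exact (step_test (hm none) hb.1 _ _).trans (by rw [ht]; rfl)
  | @loop_true k t p s₁ s₂ s₃ hs ht _ _ ih₁ ih₂ =>
    intro emb exit hb hm v
    obtain ⟨hk, hb₁⟩ := max_le_iff.1 hb
    obtain ⟨v₁, h₁⟩ := ih₁ (fun l => emb (some l)) (emb none) hb₁ (fun l => hm (some l))
      (s₁ k).head?
    obtain ⟨v₂, h₂⟩ := ih₂ emb exit hb hm v₁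
    refine ⟨v₂, .head (cfgInv_cfg hs _ _) ?_ (h₁.trans h₂)⟩
    have hk : k < R + 1 := hk
    exact (step_test (hm none) hk _ _).trans (by rw [ht]; rfl)

end Compile

/-- The machine that runs a program and then inspects the top of the stack `out`. The input is on
stack `inp`. -/
noncomputable def machine (p : Prog) (R : ℕ) (inp out : Fin (R + 1)) : Turing.FinTM2 where
  K := Fin (R + 1)
  k₀ := inp
  k₁ := out
  Γ := fun _ => Sym
  Λ := Option p.Label
  main := some p.entry
  ΛFin := Fintype.ofFinite _
  σ := Option Sym
  initialState := none
  m l :=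
    match l with
    | some l => p.code R some none l
    | none => .peek out (fun _ a => a) .halt

/-- A language is decided in space `f` by a program that starts with the input on one stack and all
other stacks empty, and that leaves another stack nonempty exactly if it accepts. -/
theorem decidableInSpace {L : Language Sym} {f : ℕ → ℕ} (p : Prog) (inp out : ℕ) (R : ℕ)
    (hinp : inp < R + 1) (hout : out < R + 1) (hp : p.bound ≤ R + 1)
    (h : ∀ x : List Sym, ∃ I s', Run I p (Function.update (fun _ => []) inp x) s' ∧
      (∀ s, I s → ∑ k : Fin (R + 1), (s k).length ≤ f x.length) ∧ (s' out ≠ [] ↔ x ∈ L)) :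
    DecidableInSpace L f := by
  refine ⟨machine p R ⟨inp, hinp⟩ ⟨out, hout⟩, Function.Embedding.refl _, {v | v ≠ none},
    fun _ => inferInstanceAs (Finite Sym), fun x => ?_⟩
  obtain ⟨I, s', hrun, hspace, hacc⟩ := h x
  set tm := machine p R ⟨inp, hinp⟩ ⟨out, hout⟩ with htm
  obtain ⟨v, hv⟩ := hrun.path (m := tm.m) some none hp (fun l => rfl) none
  have hinit : Turing.initList tm (x.map (Function.Embedding.refl Sym)) =
      cfg (some (some p.entry)) none (Function.update (fun _ => []) inp x) := by
    have : (fun k : Fin (R + 1) => @dite (List Sym) (k = ⟨inp, hinp⟩)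
        (instDecidableEqFin (R + 1) k ⟨inp, hinp⟩)
        (fun _ => x.map (Function.Embedding.refl Sym)) (fun _ => [])) =
        restrict R (Function.update (fun _ => []) inp x) := by
      funext k
      by_cases hk : k = ⟨inp, hinp⟩
      · subst hk
        have : ⇑(Function.Embedding.refl Sym) = id := rfl
        simp [restrict, this]
      · have : (k : ℕ) ≠ inp := fun h => hk (Fin.ext h)
        simp [restrict, hk, Function.update_of_ne this]
    exact congrArg (Turing.TM2.Cfg.mk (some (some p.entry)) none) this
  have hs' := hrun.inv_right
  have hpath : Path tm.step (CfgInv R I) (Turing.initList tm (x.map (Function.Embedding.refl Sym)))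
      (cfg none (s' out).head? s') := by
    rw [hinit]
    refine hv.trans (.single (cfgInv_cfg hs' _ _) ?_ (cfgInv_cfg hs' _ _))
    rfl
  refine ⟨fun c hc => ?_, _, hpath.reaches, rfl, ?_⟩
  · obtain ⟨s, hs, hcs⟩ := hpath.of_reaches rfl hc
    refine le_trans (le_of_eq ?_) (hspace s hs)
    have : ∀ k : Fin (R + 1), c.stk k = s k := fun k => congrFun hcs k
    exact Finset.sum_congr rfl fun k _ => congrArg List.length (this k)
  · rw [← hacc]
    show (s' out).head? ≠ none ↔ _
    cases s' out <;> simp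

/-! ### Stacks as numbers -/

/-- The digits of bijective numeration in base three are `1, 2, 3`. -/
def digit : Sym → ℕ
  | some false => 1
  | some true => 2
  | none => 3

/-- The number with a given stack as its word of base three digits, the least significant on top.
In bijective numeration every stack is the word of exactly one number. -/
def val : List Sym → ℕ
  | [] => 0
  | a :: l => 3 * val l + digit a

/-- The successor on words. -/
def succWord : List Sym → List Sym
  | [] => [some false]
  | some false :: l => some true :: l
  | some true :: l => none :: l
  | none :: l => some false :: succWord l

/-- The predecessor on words; it leaves the word of `0` unchanged. -/
def predWord : List Sym → List Sym
  | [] => []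
  | some false :: l => if l = [] then [] else none :: predWord l
  | some true :: l => some false :: l
  | none :: l => some true :: l

/-- The word of a number. -/
def word (n : ℕ) : List Sym := succWord^[n] []

theorem val_succWord (l : List Sym) : val (succWord l) = val l + 1 := by
  fun_induction succWord l <;> (simp_all [val, digit]; try omega)

theorem val_predWord (l : List Sym) : val (predWord l) = val l - 1 := by
  fun_induction predWord l with
  | case1 => simp [val]
  | case2 => simp [val, digit]
  | case3 l hl ih =>
    have : 0 < val l := by
      cases l with
      | nil => exact absurd rfl hl
      | cons a l => cases a with
        | none => simp [val, digit]
        | some a => cases a <;> simp [val, digit]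
    simp only [val, digit, ih]
    omega
  | case4 => simp [val, digit]
  | case5 => simp [val, digit]

theorem digit_pos (a : Sym) : 1 ≤ digit a ∧ digit a ≤ 3 := by
  rcases a with _ | _ | _ <;> simp [digit]

theorem digit_injective : Function.Injective digit := by
  intro a b h
  rcases a with _ | _ | _ <;> rcases b with _ | _ | _ <;> simp [digit] at h ⊢

theorem val_injective : Function.Injective val := by
  intro l
  induction l with
  | nil =>
    intro l' h
    cases l' with
    | nil => rfl
    | cons b l' => have := digit_pos b; simp only [val] at h; omega
  | cons a l ih =>
    intro l' h
    have ha := digit_pos a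
    cases l' with
    | nil => simp only [val] at h; omega
    | cons b l' =>
      have hb := digit_pos b
      simp only [val] at h
      rw [digit_injective (show digit a = digit b by omega), ih (show val l = val l' by omega)]

theorem val_word (n : ℕ) : val (word n) = n := by
  induction n with
  | zero => rfl
  | succ n ih => rw [word, Function.iterate_succ_apply', val_succWord]; exact congrArg (· + 1) ih

theorem word_val (l : List Sym) : word (val l) = l := val_injective (val_word _)

theorem word_succ (n : ℕ) : word (n + 1) = succWord (word n) :=
  Function.iterate_succ_apply' _ _ _

theorem word_pred (n : ℕ) : word (n - 1) = predWord (word n) :=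
  val_injective (by rw [val_word, val_predWord, val_word])

theorem word_ne_nil {n : ℕ} : word n ≠ [] ↔ n ≠ 0 := by
  refine not_congr ⟨fun h => ?_, fun h => by subst h; rfl⟩
  rw [← val_word n, h]
  rfl

theorem two_pow_length_le (l : List Sym) : 2 ^ l.length ≤ val l + 1 := by
  induction l with
  | nil => simp [val]
  | cons a l ih =>
    have := digit_pos a
    simp only [List.length_cons, pow_succ, val]
    omega

theorem val_lt (l : List Sym) : val l < 4 ^ l.length := by
  induction l with
  | nil => simp [val]
  | cons a l ih =>
    have := digit_pos a
    simp only [List.length_cons, pow_succ, val]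
    omega

/-- All stacks have height at most `ℓ`. -/
def HeightLE (ℓ : ℕ) (s : Store) : Prop := ∀ k, (s k).length ≤ ℓ

/-- The store with given contents of stack `0`, which is auxiliary, and of stack `r`. -/
def put (s : Store) (r : ℕ) (A B : List Sym) : Store :=
  fun k => if k = 0 then A else if k = r then B else s k

section put

variable {s : Store} {r ℓ : ℕ} {A B : List Sym}

theorem put_zero : put s r A B 0 = A := by simp [put]

theorem put_self (hr : r ≠ 0) : put s r A B r = B := by simp [put, hr]

theorem update_put_zero (A' : List Sym) :
    Function.update (put s r A B) 0 A' = put s r A' B := by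
  funext k
  by_cases h : k = 0 <;> simp [put, h]

theorem update_put_self (hr : r ≠ 0) (B' : List Sym) :
    Function.update (put s r A B) r B' = put s r A B' := by
  funext k
  by_cases h : k = r
  · subst h; simp [put, hr]
  · simp [put, h]

theorem heightLE_put (hs : HeightLE ℓ s) (hA : A.length ≤ ℓ) (hB : B.length ≤ ℓ) :
    HeightLE ℓ (put s r A B) := by
  intro k
  unfold put
  split_ifs <;> first | assumption | exact hs k

theorem run_push (hr : r ≠ 0) (hs : HeightLE ℓ s) (hA : A.length ≤ ℓ) (a : Sym)
    (hB : (a :: B).length ≤ ℓ) :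
    Run (HeightLE ℓ) (.push r a) (put s r A B) (put s r A (a :: B)) := by
  have hB' : B.length ≤ ℓ := by simp at hB; omega
  have h : Function.update (put s r A B) r (a :: put s r A B r) = put s r A (a :: B) := by
    rw [put_self hr, update_put_self hr]
  exact h ▸ Run.push (heightLE_put hs hA hB') (h ▸ heightLE_put hs hA hB)

theorem run_push_zero (hs : HeightLE ℓ s) (a : Sym) (hA : (a :: A).length ≤ ℓ)
    (hB : B.length ≤ ℓ) :
    Run (HeightLE ℓ) (.push 0 a) (put s r A B) (put s r (a :: A) B) := by
  have hA' : A.length ≤ ℓ := by simp at hA; omega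
  have h : Function.update (put s r A B) 0 (a :: put s r A B 0) = put s r (a :: A) B := by
    rw [put_zero, update_put_zero]
  exact h ▸ Run.push (heightLE_put hs hA' hB) (h ▸ heightLE_put hs hA hB)

theorem run_pop (hr : r ≠ 0) (hs : HeightLE ℓ s) (hA : A.length ≤ ℓ) (hB : B.length ≤ ℓ) :
    Run (HeightLE ℓ) (.pop r) (put s r A B) (put s r A B.tail) := by
  have hB' : B.tail.length ≤ ℓ := by simp; omega
  have h : Function.update (put s r A B) r (put s r A B r).tail = put s r A B.tail := by
    rw [put_self hr, update_put_self hr]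
  exact h ▸ Run.pop (heightLE_put hs hA hB) (h ▸ heightLE_put hs hA hB')

theorem run_pop_zero (hs : HeightLE ℓ s) (hA : A.length ≤ ℓ) (hB : B.length ≤ ℓ) :
    Run (HeightLE ℓ) (.pop 0) (put s r A B) (put s r A.tail B) := by
  have hA' : A.tail.length ≤ ℓ := by simp; omega
  have h : Function.update (put s r A B) 0 (put s r A B 0).tail = put s r A.tail B := by
    rw [put_zero, update_put_zero]
  exact h ▸ Run.pop (heightLE_put hs hA hB) (h ▸ heightLE_put hs hA' hB)

end put

/-- Move the digits `a` on top of stack `r` to the auxiliary stack. -/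
def unstack (r : ℕ) (a : Sym) : Prog :=
  .loop r (fun h => decide (h = some a)) (.seq (.pop r) (.push 0 a))

/-- Empty the auxiliary stack and push as many digits `a` on stack `r`. -/
def restack (r : ℕ) (a : Sym) : Prog :=
  .loop 0 Option.isSome (.seq (.pop 0) (.push r a))

theorem run_unstack {s : Store} {r ℓ : ℕ} (hr : r ≠ 0) (hs : HeightLE ℓ s) (a : Sym)
    {C : List Sym} (hC : C.head? ≠ some a) (j : ℕ) : ∀ A : List Sym, A.length + j + C.length ≤ ℓ →
    Run (HeightLE ℓ) (unstack r a) (put s r A (List.replicate j a ++ C))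
      (put s r (List.replicate j a ++ A) C) := by
  induction j with
  | zero =>
    intro A h
    refine .loop_false (heightLE_put hs (by omega) (by simp; omega)) ?_
    simpa [put_self hr] using hC
  | succ j ih =>
    intro A h
    refine .loop_true (heightLE_put hs (by omega) (by simp; omega))
      (by simp [put_self hr, List.replicate_succ])
      (.seq (run_pop hr hs (by omega) (by simp; omega))
        (run_push_zero hs a (by simp; omega) (by simp; omega))) ?_
    have := ih (a :: A) (by simp; omega)
    rw [show List.replicate (j + 1) a ++ A = List.replicate j a ++ a :: A by
      simp [List.replicate_succ']]
    simpa [List.replicate_succ, unstack] using this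

theorem run_restack {s : Store} {r ℓ : ℕ} (hr : r ≠ 0) (hs : HeightLE ℓ s) (a : Sym)
    (A : List Sym) : ∀ B : List Sym, A.length + B.length ≤ ℓ →
    Run (HeightLE ℓ) (restack r a) (put s r A B)
      (put s r [] (List.replicate A.length a ++ B)) := by
  induction A with
  | nil =>
    intro B h
    exact .loop_false (heightLE_put hs (by simp) (by simp at h; omega)) (by simp [put_zero])
  | cons x A ih =>
    intro B h
    simp only [List.length_cons] at h
    refine .loop_true (heightLE_put hs (by simp; omega) (by omega)) (by simp [put_zero])
      (.seq (run_pop_zero hs (by simp; omega) (by omega))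
        (run_push hr hs (by simp; omega) a (by simp; omega))) ?_
    have := ih (a :: B) (by simp; omega)
    rw [show List.replicate (x :: A).length a ++ B = List.replicate A.length a ++ a :: B by
      simp [List.replicate_succ']]
    exact this

theorem exists_replicate_append (a : Sym) (B : List Sym) :
    ∃ j C, B = List.replicate j a ++ C ∧ C.head? ≠ some a := by
  induction B with
  | nil => exact ⟨0, [], by simp⟩
  | cons x B ih =>
    obtain ⟨j, C, rfl, hC⟩ := ih
    by_cases hx : x = a
    · exact ⟨j + 1, C, by simp [hx, List.replicate_succ], hC⟩
    · exact ⟨0, x :: (List.replicate j a ++ C), by simp, by simpa using hx⟩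

/-- Add one to the number on stack `r`. -/
def incStack (r : ℕ) : Prog :=
  .seq (unstack r none) <| .seq
    (.ite r Option.isNone (.push r (some false))
      (.ite r (fun h => decide (h = some (some false)))
        (.seq (.pop r) (.push r (some true))) (.seq (.pop r) (.push r none))))
    (restack r (some false))

/-- Subtract one from the number on stack `r`. If all digits are `1`, the highest is dropped. -/
def decStack (r : ℕ) : Prog :=
  .seq (unstack r (some false)) <| .seq
    (.ite r Option.isNone (.pop 0)
      (.ite r (fun h => decide (h = some none))
        (.seq (.pop r) (.push r (some true))) (.seq (.pop r) (.push r (some false)))))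
    (restack r none)

theorem succWord_replicate (j : ℕ) (C : List Sym) :
    succWord (List.replicate j none ++ C) = List.replicate j (some false) ++ succWord C := by
  induction j with
  | zero => rfl
  | succ j ih => simp [List.replicate_succ, succWord, ih]

theorem predWord_replicate (j : ℕ) {C : List Sym} (hC : C ≠ []) :
    predWord (List.replicate j (some false) ++ C) = List.replicate j none ++ predWord C := by
  induction j with
  | zero => rfl
  | succ j ih => simp [List.replicate_succ, predWord, ih, hC]

theorem predWord_replicate_nil (j : ℕ) :
    predWord (List.replicate j (some false)) = List.replicate (j - 1) none := by
  induction j with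
  | zero => rfl
  | succ j ih =>
    cases j with
    | zero => rfl
    | succ j => simp_all [List.replicate_succ, predWord]

theorem run_incStack {s : Store} {r ℓ : ℕ} (hr : r ≠ 0) (hs : HeightLE ℓ s) (B : List Sym)
    (hB : B.length ≤ ℓ) (hB' : (succWord B).length ≤ ℓ) :
    Run (HeightLE ℓ) (incStack r) (put s r [] B) (put s r [] (succWord B)) := by
  obtain ⟨j, C, rfl, hC⟩ := exists_replicate_append none B
  rw [succWord_replicate] at hB' ⊢
  simp only [List.length_append, List.length_replicate] at hB hB'
  refine .seq (run_unstack hr hs none hC j [] (by simp; omega)) (.seq (s₂ := put s r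
    (List.replicate j none) (succWord C)) ?_ ?_)
  · have hI : HeightLE ℓ (put s r (List.replicate j none ++ []) C) :=
      heightLE_put hs (by simp; omega) (by omega)
    rw [List.append_nil] at hI ⊢
    rcases C with _ | ⟨_ | _ | _, C⟩
    · refine .ite_true hI (by simp [put_self hr]) (run_push hr hs (by simp; omega) _ ?_)
      simp [succWord] at hB' ⊢; omega
    · simp at hC
    · refine .ite_false hI (by simp [put_self hr]) (.ite_true hI (by simp [put_self hr])
        (.seq (run_pop hr hs (by simp; omega) (by omega))
          (run_push hr hs (by simp; omega) _ ?_)))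
      simp at hB ⊢; omega
    · refine .ite_false hI (by simp [put_self hr]) (.ite_false hI (by simp [put_self hr])
        (.seq (run_pop hr hs (by simp; omega) (by omega))
          (run_push hr hs (by simp; omega) _ ?_)))
      simp at hB ⊢; omega
  · simpa using run_restack hr hs (some false) (List.replicate j none) (succWord C)
      (by simp; omega)

theorem run_decStack {s : Store} {r ℓ : ℕ} (hr : r ≠ 0) (hs : HeightLE ℓ s) (B : List Sym)
    (hB : B.length ≤ ℓ) :
    Run (HeightLE ℓ) (decStack r) (put s r [] B) (put s r [] (predWord B)) := by
  obtain ⟨j, C, rfl, hC⟩ := exists_replicate_append (some false) B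
  simp only [List.length_append, List.length_replicate] at hB
  refine .seq (run_unstack hr hs _ hC j [] (by simp; omega)) ?_
  have hI : HeightLE ℓ (put s r (List.replicate j (some false) ++ []) C) :=
    heightLE_put hs (by simp; omega) (by omega)
  rw [List.append_nil] at hI ⊢
  rcases eq_or_ne C [] with rfl | hC'
  · refine .seq (.ite_true hI (by simp [put_self hr])
      (run_pop_zero hs (by simp; omega) (by omega))) ?_
    rw [List.append_nil, predWord_replicate_nil]
    simpa using run_restack hr hs none (List.replicate j (some false)).tail [] (by simp; omega)
  · rw [predWord_replicate j hC']
    have hlen : (predWord C).length ≤ C.length := by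
      rcases C with _ | ⟨_ | _ | _, C⟩ <;> simp_all [predWord]
    refine .seq (s₂ := put s r (List.replicate j (some false)) (predWord C)) ?_ ?_
    · rcases C with _ | ⟨_ | _ | _, C⟩
      · exact absurd rfl hC'
      · refine .ite_false hI (by simp [put_self hr]) (.ite_true hI (by simp [put_self hr])
          (.seq (run_pop hr hs (by simp; omega) (by omega))
            (run_push hr hs (by simp; omega) _ ?_)))
        simp at hB ⊢; omega
      · simp at hC
      · refine .ite_false hI (by simp [put_self hr]) (.ite_false hI (by simp [put_self hr])
          (.seq (run_pop hr hs (by simp; omega) (by omega))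
            (run_push hr hs (by simp; omega) _ ?_)))
        simp at hB ⊢; omega
    · simpa using run_restack hr hs none (List.replicate j (some false)) (predWord C)
        (by simp; omega)

/-! ### Counter programs -/

/-- The store that represents counters: counter `k` is the number on stack `k + 1`. -/
def rep (σ : ℕ → ℕ) : Store
  | 0 => []
  | k + 1 => word (σ k)

/-- A run on counters in stacks of height at most `ℓ`. -/
def CRun (ℓ : ℕ) (p : Prog) (σ σ' : ℕ → ℕ) : Prop := Run (HeightLE ℓ) p (rep σ) (rep σ')

/-- Add one to counter `k`. -/
def inc (k : ℕ) : Prog := incStack (k + 1)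

/-- Subtract one from counter `k`. -/
def dec (k : ℕ) : Prog := decStack (k + 1)

/-- Repeat a program while counter `k` is positive. -/
def whilePos (k : ℕ) (p : Prog) : Prog := .loop (k + 1) Option.isSome p

section counters

variable {ℓ : ℕ} {σ σ' σ'' : ℕ → ℕ}

theorem word_length_le {n : ℕ} (h : n < 2 ^ ℓ) : (word n).length ≤ ℓ := by
  have := two_pow_length_le (word n)
  rw [val_word] at this
  exact (Nat.pow_le_pow_iff_right (by norm_num)).1 (this.trans h)

theorem heightLE_rep (h : ∀ i, σ i < 2 ^ ℓ) : HeightLE ℓ (rep σ)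
  | 0 => by simp [rep]
  | k + 1 => word_length_le (h k)

theorem put_rep (k n : ℕ) :
    put (rep σ) (k + 1) [] (word n) = rep (Function.update σ k n) := by
  funext i
  cases i with
  | zero => rfl
  | succ i =>
    by_cases h : i = k
    · subst h; simp [put, rep]
    · simp [put, rep, h]

theorem CRun.skip (h : ∀ i, σ i < 2 ^ ℓ) : CRun ℓ .skip σ σ := Run.skip (heightLE_rep h)

theorem CRun.seq {p q : Prog} (h : CRun ℓ p σ σ') (h' : CRun ℓ q σ' σ'') :
    CRun ℓ (.seq p q) σ σ'' := Run.seq h h'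

theorem CRun.inc (h : ∀ i, σ i < 2 ^ ℓ) {k : ℕ} (hk : σ k + 1 < 2 ^ ℓ) :
    CRun ℓ (inc k) σ (Function.update σ k (σ k + 1)) := by
  have := run_incStack (Nat.succ_ne_zero k) (heightLE_rep h) (word (σ k))
    (word_length_le (h k)) (by rw [← word_succ]; exact word_length_le hk)
  rwa [← word_succ, put_rep, put_rep, Function.update_eq_self] at this

theorem CRun.dec (h : ∀ i, σ i < 2 ^ ℓ) (k : ℕ) :
    CRun ℓ (dec k) σ (Function.update σ k (σ k - 1)) := by
  have := run_decStack (Nat.succ_ne_zero k) (heightLE_rep h) (word (σ k)) (word_length_le (h k))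
  rwa [← word_pred, put_rep, put_rep, Function.update_eq_self] at this

theorem isSome_head?_rep {k : ℕ} : (rep σ (k + 1)).head?.isSome = decide (σ k ≠ 0) := by
  rw [Bool.eq_iff_iff, decide_eq_true_iff, ← word_ne_nil]
  simp only [rep]
  cases word (σ k) <;> simp

/-- A loop runs through the states `τ 0, …, τ n`. -/
theorem CRun.whilePos {p : Prog} {k : ℕ} (n : ℕ) (τ : ℕ → ℕ → ℕ)
    (hτ : ∀ t < n, τ t k ≠ 0 ∧ CRun ℓ p (τ t) (τ (t + 1))) (hn : τ n k = 0)
    (hb : ∀ i, τ n i < 2 ^ ℓ) : CRun ℓ (whilePos k p) (τ 0) (τ n) := by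
  induction n generalizing τ with
  | zero => exact Run.loop_false (heightLE_rep hb) (by rw [isSome_head?_rep]; simpa using hn)
  | succ n ih =>
    obtain ⟨h₁, h₂⟩ := hτ 0 n.succ_pos
    exact Run.loop_true h₂.inv_left (by rw [isSome_head?_rep]; simpa using h₁) h₂
      (ih (fun t => τ (t + 1)) (fun t ht => hτ (t + 1) (by omega)) hn hb)

/-- Set counter `k` to zero. -/
def clear (k : ℕ) : Prog := StackProg.whilePos k (StackProg.dec k)

theorem CRun.clear (h : ∀ i, σ i < 2 ^ ℓ) (k : ℕ) :
    CRun ℓ (clear k) σ (Function.update σ k 0) := by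
  have := CRun.whilePos (ℓ := ℓ) (p := StackProg.dec k) (k := k) (σ k)
    (fun t => Function.update σ k (σ k - t)) ?_ (by simp) ?_
  · simpa [StackProg.clear] using this
  · intro t ht
    have hb : ∀ i, Function.update σ k (σ k - t) i < 2 ^ ℓ := by
      intro i
      have := h i
      have := h k
      simp only [Function.update_apply]
      split_ifs <;> omega
    refine ⟨by simp; omega, ?_⟩
    have := CRun.dec hb k
    simpa [Nat.sub_sub] using this
  · intro i
    have := h i
    simp only [Function.update_apply]
    split_ifs <;> omega

/-- Add counter `k` to counter `k'` and set it to zero. -/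
def move (k k' : ℕ) : Prog := StackProg.whilePos k (.seq (StackProg.dec k) (StackProg.inc k'))

theorem CRun.move (h : ∀ i, σ i < 2 ^ ℓ) {k k' : ℕ} (hkk' : k ≠ k') (hs : σ k' + σ k < 2 ^ ℓ) :
    CRun ℓ (move k k') σ (Function.update (Function.update σ k 0) k' (σ k' + σ k)) := by
  have hb : ∀ t ≤ σ k, ∀ u ≤ t, ∀ i,
      Function.update (Function.update σ k (σ k - t)) k' (σ k' + u) i < 2 ^ ℓ := by
    intro t ht u hu i
    have := h i
    have := h k
    simp only [Function.update_apply]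
    split_ifs <;> omega
  have := CRun.whilePos (ℓ := ℓ) (p := .seq (StackProg.dec k) (StackProg.inc k')) (k := k) (σ k)
    (fun t => Function.update (Function.update σ k (σ k - t)) k' (σ k' + t)) ?_
    (by simp [hkk']) (hb _ le_rfl _ le_rfl)
  · simpa [StackProg.move] using this
  · intro t ht
    refine ⟨by simp [hkk']; omega, ?_⟩
    refine .seq (σ' := Function.update (Function.update σ k (σ k - (t + 1))) k' (σ k' + t)) ?_ ?_
    · have := CRun.dec (hb t ht.le t le_rfl) k
      convert this using 1
      funext i
      simp only [Function.update_apply]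
      split_ifs <;> first | rfl | omega
    · have := CRun.inc (hb (t + 1) ht t (by omega)) (k := k') (by simp; omega)
      simpa [add_assoc] using this

/-- Add counter `k` to counter `k'` by means of a counter `l` with value zero. -/
def copy (k k' l : ℕ) : Prog :=
  .seq (StackProg.whilePos k (.seq (StackProg.dec k) (.seq (StackProg.inc k') (StackProg.inc l))))
    (StackProg.move l k)

theorem CRun.copy (h : ∀ i, σ i < 2 ^ ℓ) {k k' l : ℕ} (h₁ : k ≠ k') (h₂ : k ≠ l) (h₃ : k' ≠ l)
    (hk' : σ k' = 0) (hl : σ l = 0) :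
    CRun ℓ (copy k k' l) σ (Function.update σ k' (σ k)) := by
  let τ : ℕ → ℕ → ℕ → ℕ → ℕ := fun a b c i =>
    if i = k then a else if i = k' then b else if i = l then c else σ i
  have hb : ∀ a ≤ σ k, ∀ b ≤ σ k, ∀ c ≤ σ k, ∀ i, τ a b c i < 2 ^ ℓ := by
    intro a ha b hb c hc i
    have := h i
    have := h k
    simp only [τ]
    split_ifs <;> omega
  have hloop := CRun.whilePos (ℓ := ℓ)
    (p := .seq (StackProg.dec k) (.seq (StackProg.inc k') (StackProg.inc l))) (k := k) (σ k)
    (fun t => τ (σ k - t) t t) ?_ (by simp [τ])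
    (hb _ (by omega) _ le_rfl _ le_rfl)
  · have hmove := CRun.move (hb 0 (by omega) _ le_rfl _ le_rfl) (k := l) (k' := k) h₂.symm
      (by have := h k; simp [τ, h₂.symm, h₃.symm]; omega)
    refine .seq (σ' := τ 0 (σ k) (σ k)) ?_ ?_
    · convert hloop using 1
      · funext i
        simp only [τ]
        split_ifs <;> simp_all
      · simp
    · convert hmove using 1
      funext i
      simp only [τ, Function.update_apply]
      split_ifs <;> simp_all
  · intro t ht
    refine ⟨by simp [τ]; omega, .seq (σ' := τ (σ k - (t + 1)) t t) ?_
      (.seq (σ' := τ (σ k - (t + 1)) (t + 1) t) ?_ ?_)⟩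
    · convert CRun.dec (hb (σ k - t) (by omega) t ht.le t ht.le) k using 1
      funext i
      simp only [τ, Function.update_apply]
      split_ifs <;> rfl
    · convert CRun.inc (hb (σ k - (t + 1)) (by omega) t ht.le t ht.le) (k := k')
        (by have := h k; simp [τ, h₁.symm]; omega) using 1
      funext i
      simp only [τ, Function.update_apply]
      split_ifs <;> simp_all
    · convert CRun.inc (hb (σ k - (t + 1)) (by omega) (t + 1) ht t ht.le) (k := l)
        (by have := h k; simp [τ, h₂.symm, h₃.symm]; omega) using 1
      funext i
      simp only [τ, Function.update_apply]
      split_ifs <;> simp_all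

end counters

/-! ### Functions computed with bounded counters -/

/-- A context: a type whose elements are given by natural numbers, their coordinates. -/
class Ctx (α : Type) where
  /-- the names of the coordinates -/
  ι : Type
  coord : ι → α → ℕ

instance : Ctx ℕ := ⟨Unit, fun _ n => n⟩

instance {α : Type} [Ctx α] : Ctx (α × ℕ) :=
  ⟨Option (Ctx.ι α), fun i x => i.elim x.2 fun i => Ctx.coord i x.1⟩

/-- All coordinates are at most `M`. -/
def CoordLE {α : Type} [Ctx α] (x : α) (M : ℕ) : Prop := ∀ i : Ctx.ι α, Ctx.coord i x ≤ M

/-- The function `f` is computed by programs whose counters never exceed `β M` if they are at most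
`M` initially. For each layout `ρ` of the coordinates of the argument in the counters below `d`,
there is a program that writes the value to counter `d` and changes no other counter; it uses the
counters above `d` as working space. -/
structure Comp {α : Type} [Ctx α] (β : ℕ → ℕ) (f : α → ℕ) : Prop where
  mono : Monotone β
  le : ∀ M, M ≤ β M
  bound : ∀ x M, CoordLE x M → f x ≤ β M
  run : ∀ (ρ : Ctx.ι α → ℕ) (d : ℕ), (∀ i, ρ i < d) → ∃ p, ∀ (x : α) (σ : ℕ → ℕ) (M ℓ : ℕ),
    (∀ i, σ (ρ i) = Ctx.coord i x) → (∀ i, d ≤ i → σ i = 0) → (∀ i, σ i ≤ M) → β M < 2 ^ ℓ →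
    CRun ℓ p σ (Function.update σ d (f x))

/-- The counters `σ` with new values in the counters `d, …, d + 3`. -/
def frame (σ : ℕ → ℕ) (d r k a a' : ℕ) (i : ℕ) : ℕ :=
  if i = d then r else if i = d + 1 then k else if i = d + 2 then a else
    if i = d + 3 then a' else σ i

section frame

variable {σ : ℕ → ℕ} {d r k a a' : ℕ}

theorem frame_zero : frame σ d r k a a' d = r := by simp [frame]

theorem frame_one : frame σ d r k a a' (d + 1) = k := by simp [frame]

theorem frame_two : frame σ d r k a a' (d + 2) = a := by simp [frame]

theorem frame_three : frame σ d r k a a' (d + 3) = a' := by simp [frame]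

theorem frame_of_lt {i : ℕ} (h : i < d) : frame σ d r k a a' i = σ i := by
  simp only [frame]
  rw [if_neg (by omega), if_neg (by omega), if_neg (by omega), if_neg (by omega)]

theorem frame_of_le {i : ℕ} (h : d + 4 ≤ i) : frame σ d r k a a' i = σ i := by
  simp only [frame]
  rw [if_neg (by omega), if_neg (by omega), if_neg (by omega), if_neg (by omega)]

theorem frame_le {W : ℕ} (h₀ : r ≤ W) (h₁ : k ≤ W) (h₂ : a ≤ W) (h₃ : a' ≤ W)
    (h : ∀ i, σ i ≤ W) (i : ℕ) : frame σ d r k a a' i ≤ W := by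
  have := h i
  simp only [frame]
  split_ifs <;> assumption

theorem update_frame_zero (v : ℕ) :
    Function.update (frame σ d r k a a') d v = frame σ d v k a a' := by
  funext i
  simp only [frame, Function.update_apply]
  split_ifs <;> rfl

theorem update_frame_one (v : ℕ) :
    Function.update (frame σ d r k a a') (d + 1) v = frame σ d r v a a' := by
  funext i
  simp only [frame, Function.update_apply]
  split_ifs <;> first | rfl | omega

theorem update_frame_two (v : ℕ) :
    Function.update (frame σ d r k a a') (d + 2) v = frame σ d r k v a' := by
  funext i
  simp only [frame, Function.update_apply]
  split_ifs <;> first | rfl | omega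

theorem update_frame_three (v : ℕ) :
    Function.update (frame σ d r k a a') (d + 3) v = frame σ d r k a v := by
  funext i
  simp only [frame, Function.update_apply]
  split_ifs <;> first | rfl | omega

theorem frame_eq_update (h : ∀ i, d ≤ i → σ i = 0) :
    frame σ d r 0 0 0 = Function.update σ d r := by
  have h₁ := h (d + 1) (by omega)
  have h₂ := h (d + 2) (by omega)
  have h₃ := h (d + 3) (by omega)
  funext i
  simp only [frame, Function.update_apply]
  split_ifs <;> simp_all

end frame

namespace Comp

variable {α α' : Type} [Ctx α] [Ctx α'] {β γ δ : ℕ → ℕ}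

theorem update_le {f : α → ℕ} (hf : Comp β f) {x : α} {M : ℕ} (hx : CoordLE x M) {σ : ℕ → ℕ}
    (hσ : ∀ i, σ i ≤ M) (d i : ℕ) : Function.update σ d (f x) i ≤ β M := by
  have h₁ := hf.bound x M hx
  have h₂ := hσ i
  have h₃ := hf.le M
  simp only [Function.update_apply]
  split_ifs <;> omega

/-- A larger bound is a bound. -/
theorem weaken {f : α → ℕ} (hf : Comp β f) (hγ : Monotone γ) (h : ∀ M, β M ≤ γ M) : Comp γ f where
  mono := hγ
  le M := (hf.le M).trans (h M)
  bound x M hx := (hf.bound x M hx).trans (h M)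
  run ρ d hρ := by
    obtain ⟨p, hp⟩ := hf.run ρ d hρ
    exact ⟨p, fun x σ M ℓ h₁ h₂ h₃ h₄ => hp x σ M ℓ h₁ h₂ h₃ ((h M).trans_lt h₄)⟩

theorem coord (i : Ctx.ι α) : Comp id (Ctx.coord i : α → ℕ) where
  mono := monotone_id
  le _ := le_rfl
  bound _ _ hx := hx i
  run ρ d hρ := by
    refine ⟨StackProg.copy (ρ i) d (d + 1), fun x σ M ℓ h₁ h₂ h₃ h₄ => ?_⟩
    rw [← h₁ i]
    exact CRun.copy (fun j => (h₃ j).trans_lt h₄) (hρ i).ne (Nat.lt_succ_of_lt (hρ i)).ne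
      (Nat.lt_succ_self d).ne (h₂ d le_rfl) (h₂ (d + 1) (Nat.le_succ d))

theorem zero : Comp id (fun _ : α => 0) where
  mono := monotone_id
  le _ := le_rfl
  bound _ _ _ := Nat.zero_le _
  run ρ d hρ := by
    refine ⟨.skip, fun x σ M ℓ h₁ h₂ h₃ h₄ => ?_⟩
    rw [show Function.update σ d 0 = σ by rw [← h₂ d le_rfl, Function.update_eq_self]]
    exact CRun.skip fun j => (h₃ j).trans_lt h₄

theorem succ {f : α → ℕ} (hf : Comp β f) : Comp (fun M => β M + 1) (fun x => f x + 1) where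
  mono _ _ h := Nat.add_le_add_right (hf.mono h) 1
  le M := (hf.le M).trans (Nat.le_succ _)
  bound x M hx := Nat.add_le_add_right (hf.bound x M hx) 1
  run ρ d hρ := by
    obtain ⟨p, hp⟩ := hf.run ρ d hρ
    refine ⟨.seq p (StackProg.inc d), fun x σ M ℓ h₁ h₂ h₃ h₄ => ?_⟩
    have hx : CoordLE x M := fun i => h₁ i ▸ h₃ _
    have := hf.bound x M hx
    refine .seq (hp x σ M ℓ h₁ h₂ h₃ (by omega)) ?_
    simpa using CRun.inc (σ := Function.update σ d (f x)) (k := d)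
      (fun i => (hf.update_le hx h₃ d i).trans_lt (by omega)) (by simp; omega)

theorem pred {f : α → ℕ} (hf : Comp β f) : Comp β (fun x => f x - 1) where
  mono := hf.mono
  le := hf.le
  bound x M hx := (Nat.sub_le _ _).trans (hf.bound x M hx)
  run ρ d hρ := by
    obtain ⟨p, hp⟩ := hf.run ρ d hρ
    refine ⟨.seq p (StackProg.dec d), fun x σ M ℓ h₁ h₂ h₃ h₄ => ?_⟩
    have hx : CoordLE x M := fun i => h₁ i ▸ h₃ _
    refine .seq (hp x σ M ℓ h₁ h₂ h₃ h₄) ?_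
    simpa using CRun.dec (σ := Function.update σ d (f x))
      (fun i => (hf.update_le hx h₃ d i).trans_lt h₄) d

/-- Substitution of coordinates. -/
theorem rename {f : α' → ℕ} (hf : Comp β f) (h : α → α') (φ : Ctx.ι α' → Ctx.ι α)
    (hφ : ∀ i x, Ctx.coord i (h x) = Ctx.coord (φ i) x) : Comp β (fun x => f (h x)) where
  mono := hf.mono
  le := hf.le
  bound x M hx := hf.bound _ M fun i => hφ i x ▸ hx _
  run ρ d hρ := by
    obtain ⟨p, hp⟩ := hf.run (fun i => ρ (φ i)) d fun i => hρ _
    exact ⟨p, fun x σ M ℓ h₁ h₂ h₃ h₄ => hp (h x) σ M ℓ (fun i => (h₁ _).trans (hφ i x).symm)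
      h₂ h₃ h₄⟩

/-- Composition: the value of `f` becomes a new coordinate. -/
theorem bind {f : α → ℕ} {g : α × ℕ → ℕ} (hf : Comp β f) (hg : Comp γ g) :
    Comp (fun M => γ (β M)) (fun x => g (x, f x)) where
  mono _ _ h := hg.mono (hf.mono h)
  le M := (hf.le M).trans (hg.le _)
  bound x M hx := hg.bound _ _ fun i => by
    cases i with
    | none => exact hf.bound x M hx
    | some i => exact (hx i).trans (hf.le M)
  run ρ d hρ := by
    obtain ⟨p, hp⟩ := hf.run ρ d hρ
    obtain ⟨q, hq⟩ := hg.run (fun i => i.elim d ρ) (d + 1) fun i => by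
      cases i with
      | none => exact Nat.lt_succ_self d
      | some i => exact Nat.lt_succ_of_lt (hρ i)
    refine ⟨.seq p (.seq q (.seq (StackProg.clear d) (StackProg.move (d + 1) d))),
      fun x σ M ℓ h₁ h₂ h₃ h₄ => ?_⟩
    have hx : CoordLE x M := fun i => h₁ i ▸ h₃ _
    set σ₁ := Function.update σ d (f x) with hσ₁
    have hb₁ : ∀ i, σ₁ i ≤ β M := hf.update_le hx h₃ d
    have hx₁ : CoordLE (x, f x) (β M) := fun i => by
      cases i with
      | none => exact hf.bound x M hx
      | some i => exact (hx i).trans (hf.le M)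
    set σ₂ := Function.update σ₁ (d + 1) (g (x, f x)) with hσ₂
    have hb₂ : ∀ i, σ₂ i < 2 ^ ℓ := fun i => (hg.update_le hx₁ hb₁ _ i).trans_lt h₄
    refine .seq (hp x σ M ℓ h₁ h₂ h₃ ((hg.le _).trans_lt h₄)) (.seq (hq (x, f x) σ₁ (β M) ℓ
      ?_ ?_ hb₁ h₄) (.seq (CRun.clear hb₂ d) ?_))
    · intro i
      cases i with
      | none => simp [hσ₁, Ctx.coord]
      | some i => simpa [hσ₁, Ctx.coord, (hρ i).ne] using h₁ i
    · intro i hi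
      rw [hσ₁, Function.update_of_ne (by omega)]
      exact h₂ i (by omega)
    · have hd : σ (d + 1) = 0 := h₂ _ (by omega)
      convert CRun.move (σ := Function.update σ₂ d 0) (ℓ := ℓ) (k := d + 1) (k' := d) ?_
        (by omega) ?_ using 1
      · funext i
        simp only [hσ₂, hσ₁, Function.update_apply]
        split_ifs <;> simp_all
      · intro i
        have := hb₂ i
        simp only [Function.update_apply]
        split_ifs <;> omega
      · have := hb₂ (d + 1)
        simpa using this

/-- Primitive recursion, if there is a bound on its values. -/
theorem prec {n b : α → ℕ} {s : (α × ℕ) × ℕ → ℕ} {β₁ β₂ β₃ B : ℕ → ℕ} (hn : Comp β₁ n)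
    (hb : Comp β₂ b) (hs : Comp β₃ s) (hB : Monotone B)
    (hbd : ∀ x M, CoordLE x M → ∀ k ≤ n x,
      Nat.rec (motive := fun _ => ℕ) (b x) (fun k a => s ((x, k), a)) k ≤ B M) :
    Comp (fun M => β₃ (β₂ (β₁ M) + B M))
      (fun x => Nat.rec (motive := fun _ => ℕ) (b x) (fun k a => s ((x, k), a)) (n x)) where
  mono _ _ h := hs.mono (Nat.add_le_add (hb.mono (hn.mono h)) (hB h))
  le M := (((hn.le M).trans (hb.le _)).trans (Nat.le_add_right _ _)).trans (hs.le _)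
  bound x M hx := by
    have := hbd x M hx (n x) le_rfl
    exact le_trans (by omega) (hs.le _)
  run ρ d hρ := by
    obtain ⟨pn, hpn⟩ := hn.run ρ d hρ
    obtain ⟨pb, hpb⟩ := hb.run ρ (d + 2) fun i => by have := hρ i; omega
    obtain ⟨ps, hps⟩ := hs.run (fun i => i.elim (d + 2) fun i => i.elim (d + 1) ρ) (d + 3)
      fun i => by
        rcases i with _ | _ | i
        · exact Nat.lt_succ_self _
        · show d + 1 < d + 3
          omega
        · have := hρ i
          show ρ i < d + 3
          omega
    refine ⟨.seq pn (.seq pb (.seq (StackProg.whilePos d (.seq (StackProg.dec d) (.seq ps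
      (.seq (StackProg.clear (d + 2)) (.seq (StackProg.move (d + 3) (d + 2))
        (StackProg.inc (d + 1))))))) (.seq (StackProg.clear (d + 1))
          (StackProg.move (d + 2) d)))), fun x σ M ℓ h₁ h₂ h₃ h₄ => ?_⟩
    have hx : CoordLE x M := fun i => h₁ i ▸ h₃ _
    set F : ℕ → ℕ := fun k =>
      Nat.rec (motive := fun _ => ℕ) (b x) (fun k a => s ((x, k), a)) k with hF
    have hFB : ∀ k ≤ n x, F k ≤ B M := hbd x M hx
    set V := β₂ (β₁ M) + B M with hV
    have hVℓ : V < 2 ^ ℓ := (hs.le V).trans_lt h₄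
    have hβ₁ := hb.le (β₁ M)
    have hM := hn.le M
    have hMV : M ≤ V := by omega
    have hnV : n x ≤ V := (hn.bound x M hx).trans (by omega)
    have hFV : ∀ k ≤ n x, F k ≤ V := fun k hk => (hFB k hk).trans (by omega)
    -- The counters are: remaining steps, index, accumulator and the next accumulator.
    have hfr : ∀ r k a a', r ≤ n x → k ≤ n x → a ≤ V → a' ≤ V → ∀ i, frame σ d r k a a' i < 2 ^ ℓ :=
      fun r k a a' hr hk ha ha' i => (frame_le (hr.trans hnV) (hk.trans hnV) ha ha'
        (fun j => (h₃ j).trans hMV) i).trans_lt hVℓ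
    have hρfr : ∀ r k a a' i, frame σ d r k a a' (ρ i) = Ctx.coord i x := fun r k a a' i =>
      (frame_of_lt (hρ i)).trans (h₁ i)
    have hzero : ∀ r k a i, d + 3 ≤ i → frame σ d r k a 0 i = 0 := by
      intro r k a i hi
      rcases Nat.lt_or_ge i (d + 4) with h | h
      · rw [show i = d + 3 by omega]
        exact frame_three
      · exact (frame_of_le h).trans (h₂ i (by omega))
    refine .seq (σ' := frame σ d (n x) 0 0 0) ?_ (.seq (σ' := frame σ d (n x) 0 (F 0) 0) ?_
      (.seq (σ' := frame σ d 0 (n x) (F (n x)) 0) ?_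
        (.seq (σ' := frame σ d 0 0 (F (n x)) 0) ?_ ?_)))
    · simpa only [frame_eq_update h₂] using
        hpn x σ M ℓ h₁ h₂ h₃ (lt_of_le_of_lt (by omega) hVℓ)
    · have := hpb x (frame σ d (n x) 0 0 0) (β₁ M) ℓ (hρfr _ _ _ _) ?_
        (frame_le (hn.bound x M hx) (by omega) (by omega) (by omega) fun j => (h₃ j).trans hM)
        (lt_of_le_of_lt (by omega) hVℓ)
      · rwa [update_frame_two] at this
      · intro i hi
        rcases Nat.lt_or_ge i (d + 3) with h | h
        · rw [show i = d + 2 by omega]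
          exact frame_two
        · exact hzero _ _ _ i h
    · have := CRun.whilePos (ℓ := ℓ) (k := d) (n x) (fun t => frame σ d (n x - t) t (F t) 0)
        (p := .seq (StackProg.dec d) (.seq ps (.seq (StackProg.clear (d + 2))
          (.seq (StackProg.move (d + 3) (d + 2)) (StackProg.inc (d + 1)))))) ?_
        (by simp only [Nat.sub_self]; exact frame_zero)
        (hfr _ _ _ _ (by omega) le_rfl (hFV _ le_rfl) (by omega))
      · simpa only [Nat.sub_self, Nat.sub_zero] using this
      · intro t ht
        have ht₁ := hFV t ht.le
        have ht₂ := hFV (t + 1) ht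
        refine ⟨by simp only [frame_zero]; omega,
          .seq (σ' := frame σ d (n x - (t + 1)) t (F t) 0) ?_
          (.seq (σ' := frame σ d (n x - (t + 1)) t (F t) (F (t + 1))) ?_
          (.seq (σ' := frame σ d (n x - (t + 1)) t 0 (F (t + 1))) ?_
          (.seq (σ' := frame σ d (n x - (t + 1)) t (F (t + 1)) 0) ?_ ?_)))⟩
        · have := CRun.dec (hfr (n x - t) t (F t) 0 (by omega) ht.le ht₁ (by omega)) d
          rwa [update_frame_zero, frame_zero, Nat.sub_sub] at this
        · have := hps ((x, t), F t) (frame σ d (n x - (t + 1)) t (F t) 0) V ℓ ?_ (hzero _ _ _)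
            (frame_le (by omega) (by omega) ht₁ (by omega) fun j => (h₃ j).trans hMV) h₄
          · rwa [update_frame_three] at this
          · rintro (_ | _ | i)
            · exact frame_two
            · exact frame_one
            · exact hρfr _ _ _ _ i
        · have := CRun.clear (hfr (n x - (t + 1)) t (F t) (F (t + 1)) (by omega) ht.le ht₁ ht₂)
            (d + 2)
          rwa [update_frame_two] at this
        · have := CRun.move (hfr (n x - (t + 1)) t 0 (F (t + 1)) (by omega) ht.le (by omega) ht₂)
            (k := d + 3) (k' := d + 2) (by omega)
            (by simp only [frame_two, frame_three]; omega)
          rwa [update_frame_three, update_frame_two, frame_two, frame_three, zero_add] at this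
        · have := CRun.inc (hfr (n x - (t + 1)) t (F (t + 1)) 0 (by omega) ht.le ht₂ (by omega))
            (k := d + 1) (by simp only [frame_one]; omega)
          rwa [update_frame_one, frame_one] at this
    · have := CRun.clear (hfr 0 (n x) (F (n x)) 0 (by omega) le_rfl (hFV _ le_rfl)
        (by omega)) (d + 1)
      rwa [update_frame_one] at this
    · have hF' := hFV _ le_rfl
      have := CRun.move (hfr 0 0 (F (n x)) 0 (by omega) (by omega) hF' (by omega))
        (k := d + 2) (k' := d) (by omega) (by simp only [frame_zero, frame_two]; omega)
      rwa [update_frame_two, update_frame_zero, frame_zero, frame_two, zero_add,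
        frame_eq_update h₂] at this

end Comp

/-! ### Functions computed in linear space -/

section tame

variable {α α' : Type} [Ctx α] [Ctx α']

/-- The function is computed with counters that stay linear in the arguments, that is, in space
linear in the lengths of the arguments. -/
def Tame (f : α → ℕ) : Prop := ∃ c, Comp (fun M => c * (M + 1)) f

/-- The values are at most linear in the arguments. -/
def LinBdd (f : α → ℕ) : Prop := ∃ c, ∀ x M, CoordLE x M → f x ≤ c * (M + 1)

theorem monotone_linear (c : ℕ) : Monotone fun M => c * (M + 1) :=
  fun _ _ h => Nat.mul_le_mul_left c (Nat.succ_le_succ h)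

theorem Tame.linBdd {f : α → ℕ} (hf : Tame f) : LinBdd f :=
  let ⟨c, hc⟩ := hf
  ⟨c, hc.bound⟩

theorem LinBdd.add {f g : α → ℕ} (hf : LinBdd f) (hg : LinBdd g) : LinBdd fun x => f x + g x := by
  obtain ⟨a, ha⟩ := hf
  obtain ⟨b, hb⟩ := hg
  exact ⟨a + b, fun x M h => (Nat.add_le_add (ha x M h) (hb x M h)).trans_eq (by ring)⟩

namespace Tame

theorem coord (i : Ctx.ι α) : Tame (Ctx.coord i : α → ℕ) :=
  ⟨1, (Comp.coord i).weaken (monotone_linear 1) fun M => by simp⟩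

theorem var : Tame fun n : ℕ => n := coord (α := ℕ) ()

theorem snd : Tame fun x : α × ℕ => x.2 := coord (α := α × ℕ) none

theorem fst {f : α → ℕ} (hf : Tame f) : Tame fun x : α × ℕ => f x.1 :=
  let ⟨c, hc⟩ := hf
  ⟨c, hc.rename (α := α × ℕ) Prod.fst some fun _ _ => rfl⟩

theorem succ {f : α → ℕ} (hf : Tame f) : Tame fun x => f x + 1 := by
  obtain ⟨c, hc⟩ := hf
  refine ⟨c + 1, hc.succ.weaken (monotone_linear _) fun M => ?_⟩
  rw [add_mul]
  omega

theorem const (n : ℕ) : Tame fun _ : α => n := by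
  induction n with
  | zero => exact ⟨1, Comp.zero.weaken (monotone_linear 1) fun M => by simp⟩
  | succ n ih => exact ih.succ

theorem pred {f : α → ℕ} (hf : Tame f) : Tame fun x => f x - 1 :=
  let ⟨c, hc⟩ := hf
  ⟨c, hc.pred⟩

theorem prec {n b B : α → ℕ} {s : α → ℕ → ℕ → ℕ} (hn : Tame n) (hb : Tame b)
    (hs : Tame fun y : (α × ℕ) × ℕ => s y.1.1 y.1.2 y.2) (hB : LinBdd B)
    (h : ∀ x, ∀ k ≤ n x, Nat.rec (motive := fun _ => ℕ) (b x) (s x) k ≤ B x) :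
    Tame fun x => Nat.rec (motive := fun _ => ℕ) (b x) (s x) (n x) := by
  obtain ⟨c₁, h₁⟩ := hn
  obtain ⟨c₂, h₂⟩ := hb
  obtain ⟨c₃, h₃⟩ := hs
  obtain ⟨c₄, h₄⟩ := hB
  refine ⟨c₃ * (c₂ * (c₁ + 1) + c₄ + 1), (Comp.prec h₁ h₂ h₃ (monotone_linear c₄)
    fun x M hx k hk => (h x k hk).trans (h₄ x M hx)).weaken (monotone_linear _) fun M => ?_⟩
  rw [mul_assoc]
  refine Nat.mul_le_mul_left c₃ ?_
  have : c₂ * (c₁ * (M + 1) + 1) ≤ c₂ * ((c₁ + 1) * (M + 1)) :=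
    Nat.mul_le_mul_left c₂ (by rw [add_mul]; omega)
  calc c₂ * (c₁ * (M + 1) + 1) + c₄ * (M + 1) + 1
      ≤ c₂ * ((c₁ + 1) * (M + 1)) + c₄ * (M + 1) + (M + 1) := by omega
    _ = _ := by ring

theorem add {f g : α → ℕ} (hf : Tame f) (hg : Tame g) : Tame fun x => f x + g x := by
  have hrec : ∀ x k, Nat.rec (motive := fun _ => ℕ) (f x) (fun _ a => a + 1) k = f x + k := by
    intro x k
    induction k with
    | zero => rfl
    | succ k ih => exact congrArg (· + 1) ih
  have := prec (s := fun _ _ a => a + 1) hg hf snd.succ (hf.linBdd.add hg.linBdd) fun x k hk => by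
    rw [hrec]; omega
  simpa only [hrec] using this

theorem sub {f g : α → ℕ} (hf : Tame f) (hg : Tame g) : Tame fun x => f x - g x := by
  have hrec : ∀ x k, Nat.rec (motive := fun _ => ℕ) (f x) (fun _ a => a - 1) k = f x - k := by
    intro x k
    induction k with
    | zero => rfl
    | succ k ih => exact congrArg (· - 1) ih
  have := prec (s := fun _ _ a => a - 1) hg hf snd.pred hf.linBdd fun x k hk => by
    rw [hrec]; omega
  simpa only [hrec] using this

end Tame

/-- The truth value of a proposition as a number. -/
noncomputable def ind (P : Prop) : ℕ := open Classical in if P then 1 else 0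

theorem ind_of {P : Prop} (h : P) : ind P = 1 := if_pos h

theorem ind_of_not {P : Prop} (h : ¬P) : ind P = 0 := if_neg h

theorem ind_le_one (P : Prop) : ind P ≤ 1 := by
  unfold ind
  split_ifs <;> omega

theorem ind_eq_one {P : Prop} : ind P = 1 ↔ P := by
  by_cases h : P <;> simp [ind, h]

theorem ind_ite (P : Prop) [Decidable P] : ind P = if P then 1 else 0 := by
  unfold ind
  congr

/-- The predicate is decided in linear space. -/
def TameP (P : α → Prop) : Prop := Tame fun x => ind (P x)

namespace TameP

theorem congr {P Q : α → Prop} (hP : TameP P) (h : ∀ x, P x ↔ Q x) : TameP Q := by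
  rwa [show Q = P from funext fun x => propext (h x).symm]

theorem eq_zero {f : α → ℕ} (hf : Tame f) : TameP fun x => f x = 0 := by
  have : (fun x => ind (f x = 0)) = fun x => 1 - f x := by
    funext x
    rw [ind_ite]
    split_ifs <;> omega
  rw [TameP, this]
  exact (Tame.const 1).sub hf

theorem not {P : α → Prop} (hP : TameP P) : TameP fun x => ¬P x :=
  (eq_zero hP).congr fun x => by by_cases h : P x <;> simp [ind, h]

end TameP

theorem Tame.ite {P : α → Prop} [DecidablePred P] {f g : α → ℕ} (hP : TameP P) (hf : Tame f)
    (hg : Tame g) : Tame fun x => if P x then f x else g x := by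
  have := prec (s := fun x _ _ => f x) hP hg hf.fst.fst (hf.linBdd.add hg.linBdd) fun x k hk => by
    cases k with
    | zero => exact Nat.le_add_left _ _
    | succ k => exact Nat.le_add_right _ _
  convert this using 2 with x
  by_cases h : P x
  · rw [if_pos h, ind_of h]
    rfl
  · rw [if_neg h, ind_of_not h]
    rfl

namespace TameP

theorem and {P Q : α → Prop} (hP : TameP P) (hQ : TameP Q) : TameP fun x => P x ∧ Q x := by
  classical
  have := Tame.ite hP hQ (Tame.const 0)
  unfold TameP
  convert this using 2 with x
  by_cases h : P x <;> simp [h, ind]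

theorem or {P Q : α → Prop} (hP : TameP P) (hQ : TameP Q) : TameP fun x => P x ∨ Q x :=
  (hP.not.and hQ.not).not.congr fun x => by tauto

theorem imp {P Q : α → Prop} (hP : TameP P) (hQ : TameP Q) : TameP fun x => P x → Q x :=
  (hP.not.or hQ).congr fun x => by tauto

theorem le {f g : α → ℕ} (hf : Tame f) (hg : Tame g) : TameP fun x => f x ≤ g x :=
  (eq_zero (hf.sub hg)).congr fun x => by omega

theorem lt {f g : α → ℕ} (hf : Tame f) (hg : Tame g) : TameP fun x => f x < g x :=
  le hf.succ hg

theorem eq {f g : α → ℕ} (hf : Tame f) (hg : Tame g) : TameP fun x => f x = g x :=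
  ((le hf hg).and (le hg hf)).congr fun x => by omega

theorem ball {n : α → ℕ} {P : α → ℕ → Prop} (hn : Tame n)
    (hP : TameP fun y : α × ℕ => P y.1 y.2) : TameP fun x => ∀ j < n x, P x j := by
  classical
  have hrec : ∀ x k, Nat.rec (motive := fun _ => ℕ) 1 (fun j a => if P x j then a else 0) k
      = ind (∀ j < k, P x j) := by
    intro x k
    induction k with
    | zero => simp [ind]
    | succ k ih =>
      show (if P x k then _ else 0) = _
      rw [ih]
      by_cases h : P x k
      · rw [if_pos h]
        refine congrArg ind (propext ⟨fun h' j hj => ?_, fun h' j hj => h' j (by omega)⟩)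
        rcases Nat.lt_succ_iff_lt_or_eq.1 hj with hj | rfl
        · exact h' j hj
        · exact h
      · rw [if_neg h, ind_of_not fun h' => h (h' k k.lt_succ_self)]
  have := Tame.prec (s := fun x j a => if P x j then a else 0) hn (Tame.const 1)
    (Tame.ite (P := fun y : (α × ℕ) × ℕ => P y.1.1 y.1.2) (Tame.fst hP) Tame.snd (Tame.const 0))
    (Tame.const (α := α) 1).linBdd fun x k hk => by rw [hrec]; exact ind_le_one _
  unfold TameP
  simpa only [hrec] using this

theorem bex {n : α → ℕ} {P : α → ℕ → Prop} (hn : Tame n)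
    (hP : TameP fun y : α × ℕ => P y.1 y.2) : TameP fun x => ∃ j < n x, P x j :=
  (ball (P := fun x j => ¬P x j) hn hP.not).not.congr fun x => by push Not; rfl

theorem forall_bool {P : α → Bool → Prop} (hP : ∀ b, TameP fun x => P x b) :
    TameP fun x => ∀ b, P x b :=
  ((hP false).and (hP true)).congr fun x => by simp

theorem exists_bool {P : α → Bool → Prop} (hP : ∀ b, TameP fun x => P x b) :
    TameP fun x => ∃ b, P x b :=
  ((hP false).or (hP true)).congr fun x => by simp

end TameP

namespace Tame

theorem mod {f g : α → ℕ} (hf : Tame f) (hg : Tame g) : Tame fun x => f x % g x := by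
  have hrec : ∀ x k, Nat.rec (motive := fun _ => ℕ) 0
      (fun _ r => if r + 1 = g x then 0 else r + 1) k = k % g x := by
    intro x k
    induction k with
    | zero => simp
    | succ k ih =>
      show (if _ + 1 = g x then 0 else _ + 1) = _
      rw [ih]
      rcases Nat.eq_zero_or_pos (g x) with h | h
      · simp [h]
      · have := Nat.mod_lt k h
        rw [Nat.add_mod]
        rcases Nat.lt_or_ge 1 (g x) with h₁ | h₁
        · rw [Nat.mod_eq_of_lt h₁]
          split_ifs with h₂
          · rw [h₂, Nat.mod_self]
          · exact (Nat.mod_eq_of_lt (by omega)).symm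
        · have h₁ : g x = 1 := by omega
          simp [h₁, Nat.mod_one]
  have := prec (s := fun x _ r => if r + 1 = g x then 0 else r + 1) hf (const 0)
    (ite (TameP.eq snd.succ hg.fst.fst) (const 0) snd.succ) hf.linBdd
    fun x k hk => by rw [hrec]; exact (Nat.mod_le _ _).trans hk
  simpa only [hrec] using this

theorem div {f g : α → ℕ} (hf : Tame f) (hg : Tame g) : Tame fun x => f x / g x := by
  have hrec : ∀ x k, Nat.rec (motive := fun _ => ℕ) 0
      (fun k q => if (k + 1) % g x = 0 then q + 1 else q) k = k / g x := by
    intro x k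
    induction k with
    | zero => simp
    | succ k ih =>
      show (if (k + 1) % g x = 0 then _ + 1 else _) = _
      simp only [ih, Nat.succ_div, Nat.dvd_iff_mod_eq_zero]
      split_ifs <;> rfl
  have := prec (s := fun x k q => if (k + 1) % g x = 0 then q + 1 else q) hf (const 0)
    (ite (TameP.eq_zero (snd.fst.succ.mod hg.fst.fst)) snd.succ snd) hf.linBdd
    fun x k hk => by rw [hrec]; exact (Nat.div_le_self _ _).trans hk
  simpa only [hrec] using this

end Tame

/-- The digit of `x` with index `i` in base `b`. -/
def dig (b x i : ℕ) : ℕ := x / b ^ i % b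

theorem Tame.div_pow {f g h : α → ℕ} (hf : Tame f) (hg : Tame g) (hh : Tame h) :
    Tame fun x => f x / g x ^ h x := by
  have hrec : ∀ x k, Nat.rec (motive := fun _ => ℕ) (f x) (fun _ y => y / g x) k
      = f x / g x ^ k := by
    intro x k
    induction k with
    | zero => simp
    | succ k ih =>
      show _ / g x = _
      rw [ih, Nat.div_div_eq_div_mul, pow_succ]
  have := prec (s := fun x _ y => y / g x) hh hf (snd.div hg.fst.fst) hf.linBdd
    fun x k hk => by rw [hrec]; exact Nat.div_le_self _ _
  simpa only [hrec] using this

theorem Tame.dig {f g h : α → ℕ} (hf : Tame f) (hg : Tame g) (hh : Tame h) :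
    Tame fun x => dig (f x) (g x) (h x) :=
  (hg.div_pow hf hh).mod hf

/-- Every finite sequence of digits is that of a number. -/
theorem exists_dig_eq {b : ℕ} (hb : 0 < b) (m : ℕ) (e : ℕ → ℕ) (he : ∀ i < m, e i < b) :
    ∃ x < b ^ m, ∀ i < m, dig b x i = e i := by
  induction m generalizing e with
  | zero => exact ⟨0, by simp, by simp⟩
  | succ m ih =>
    obtain ⟨y, hy, hd⟩ := ih (fun i => e (i + 1)) fun i hi => he _ (by omega)
    have h0 := he 0 (by omega)
    refine ⟨e 0 + b * y, ?_, ?_⟩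
    · calc e 0 + b * y < b + b * y := by omega
        _ = b * (y + 1) := by ring
        _ ≤ b * b ^ m := Nat.mul_le_mul_left b hy
        _ = b ^ (m + 1) := by ring
    · rintro (_ | i) hi
      · simp [dig, Nat.mod_eq_of_lt h0]
      · rw [← hd i (by omega), dig, dig, pow_succ', ← Nat.div_div_eq_div_mul,
          Nat.add_mul_div_left _ _ hb, Nat.div_eq_of_lt h0, zero_add]

end tame

/-! ### Languages in exponential space -/

theorem comp_two_pow : ∃ c, Comp (fun M => c * 2 ^ M) fun n : ℕ => 2 ^ n := by
  obtain ⟨c₁, h₁⟩ : Tame fun n : ℕ => n := Tame.var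
  obtain ⟨c₂, h₂⟩ : Tame fun _ : ℕ => 1 := Tame.const 1
  obtain ⟨c₃, h₃⟩ : Tame fun y : (ℕ × ℕ) × ℕ => y.2 + y.2 := Tame.snd.add Tame.snd
  have hrec : ∀ k, Nat.rec (motive := fun _ => ℕ) 1 (fun _ a => a + a) k = 2 ^ k := by
    intro k
    induction k with
    | zero => rfl
    | succ k ih => rw [pow_succ, mul_two, ← ih]
  have hmono : Monotone fun M => 2 ^ M := pow_right_mono₀ (by norm_num : (1 : ℕ) ≤ 2)
  have h := Comp.prec h₁ h₂ h₃ (B := fun M => 2 ^ M) hmono fun x M hx k hk => by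
    simp only [hrec]
    exact hmono (hk.trans (hx ()))
  simp only [hrec] at h
  refine ⟨c₃ * (c₂ * (c₁ + 1) + 2), h.weaken (fun a b hab => Nat.mul_le_mul_left _ (hmono hab))
    fun M => ?_⟩
  have hM : M + 1 ≤ 2 ^ M := Nat.lt_two_pow_self
  have hpos : 1 ≤ 2 ^ M := Nat.one_le_two_pow
  rw [mul_assoc]
  refine Nat.mul_le_mul_left c₃ ?_
  have : c₂ * (c₁ * (M + 1) + 1) ≤ c₂ * ((c₁ + 1) * 2 ^ M) :=
    Nat.mul_le_mul_left c₂ (by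
      rw [add_mul]; exact Nat.add_le_add (Nat.mul_le_mul_left _ hM) (by omega))
  calc c₂ * (c₁ * (M + 1) + 1) + 2 ^ M + 1
      ≤ c₂ * ((c₁ + 1) * 2 ^ M) + 2 ^ M + 2 ^ M := by omega
    _ = _ := by ring

/-- A language is in EXPSPACE if it is decided in linear space after a word with number `n` has been
supplemented by the number `2 ^ n`, whose length is exponential in that of the word. -/
theorem inEXPSPACE_of_tameP {P : ℕ → ℕ → Prop} (hP : TameP fun y : ℕ × ℕ => P y.1 y.2)
    {L : Language (Option Bool)} (hL : ∀ x, x ∈ L ↔ P (val x) (2 ^ val x)) : InEXPSPACE L := by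
  obtain ⟨c₁, h₁⟩ := comp_two_pow
  obtain ⟨c₂, h₂⟩ := hP
  have hcomp := h₁.bind h₂
  obtain ⟨p, hp⟩ := hcomp.run (fun _ => 0) 1 fun _ => Nat.one_pos
  set c := c₂ * (c₁ + 1) with hc
  set R := max p.bound 2 with hR
  refine ⟨2 * Polynomial.X + Polynomial.C (R + 1 + c + 1), ?_⟩
  refine decidableInSpace p 1 2 R (by omega) (by omega) (by omega) fun x => ?_
  set n := val x with hn
  set ℓ := n + c + 1 with hℓ
  refine ⟨HeightLE ℓ, rep (Function.update (Function.update (fun _ => 0) 0 n) 1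
    (ind (P n (2 ^ n)))), ?_, ?_, ?_⟩
  · have h := hp n (Function.update (fun _ => 0) 0 n) n ℓ (fun _ => by simp [Ctx.coord])
      (fun i hi => by rw [Function.update_of_ne (by omega)])
      (fun i => by simp only [Function.update_apply]; split_ifs <;> omega) ?_
    · have hrep : rep (Function.update (fun _ => 0) 0 n) = Function.update (fun _ => []) 1 x := by
        funext k
        rcases k with _ | _ | k
        · rfl
        · simp [rep, hn, word_val]
        · simp [rep, word]
      rw [CRun, hrep] at h
      exact h
    · have h₁ : 1 ≤ 2 ^ n := Nat.one_le_two_pow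
      have h₂ : c < 2 ^ c := Nat.lt_two_pow_self
      calc c₂ * (c₁ * 2 ^ n + 1) ≤ c₂ * ((c₁ + 1) * 2 ^ n) :=
            Nat.mul_le_mul_left _ (by rw [add_mul]; omega)
        _ = 2 ^ n * c := by rw [hc]; ring
        _ ≤ 2 ^ n * 2 ^ c := Nat.mul_le_mul_left _ h₂.le
        _ < 2 ^ n * 2 ^ c * 2 := by have := Nat.two_pow_pos n; have := Nat.two_pow_pos c; nlinarith
        _ = 2 ^ ℓ := by rw [hℓ]; ring
  · intro s hs
    have hval : n < 4 ^ x.length := val_lt x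
    have hle : ∑ k : Fin (R + 1), (s k).length ≤ (R + 1) * ℓ := by
      simpa using Finset.sum_le_sum fun (k : Fin (R + 1)) (_ : k ∈ Finset.univ) => hs k
    refine hle.trans ?_
    have e : (2 * Polynomial.X + Polynomial.C (R + 1 + c + 1) : Polynomial ℕ).eval x.length
        = 2 * x.length + (R + 1 + (c + 1)) := by simp; ring
    rw [e, pow_add, pow_add, pow_mul]
    have h₁ : R + 1 ≤ 2 ^ (R + 1) := Nat.lt_two_pow_self.le
    have h₂ : c + 2 ≤ 2 ^ (c + 1) := Nat.lt_two_pow_self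
    have h₃ : ℓ ≤ 4 ^ x.length * 2 ^ (c + 1) := by
      have : 4 ^ x.length * (c + 2) ≤ 4 ^ x.length * 2 ^ (c + 1) := Nat.mul_le_mul_left _ h₂
      have h₄ : 1 ≤ 4 ^ x.length := Nat.one_le_pow _ _ (by norm_num)
      nlinarith
    calc (R + 1) * ℓ ≤ 2 ^ (R + 1) * (4 ^ x.length * 2 ^ (c + 1)) := Nat.mul_le_mul h₁ h₃
      _ = _ := by norm_num; ring
  · rw [hL]
    simp only [rep, Function.update_self]
    rw [word_ne_nil, ← hn]
    by_cases h : P n (2 ^ n) <;> simp only [ind, h, if_true, if_false] <;> simp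

end StackProg

/-! ### Solving the game on the automaton -/

namespace TDGCSolution

section game

variable {Q S : Type} (D : GameDFA Q)

/-- The state after a round with bits `b` of `∀` and moves `m`. -/
def nxt (q : Q) (b m : Fin 2 → Bool) : Q := D.evalFrom q [b 0, b 1, m 0, m 1]

theorem mem_accept {q : Q} : q ∈ D.accept ↔ q ∈ D.winE ∨ q ∈ D.winA := by
  rw [D.accept_eq]
  rfl

/-! ### The universal team -/

/-- From the state `q`, the universal player wins within `k` rounds. -/
def UWin : ℕ → Q → Prop
  | 0, q => q ∉ D.winE ∧ q ∈ D.winA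
  | k + 1, q => UWin k q ∨ q ∉ D.accept ∧ ∃ b, ∀ m, UWin k (nxt D q b m)

theorem UWin.mono {k l : ℕ} (h : k ≤ l) {q : Q} (hq : UWin D k q) : UWin D l q := by
  induction h with
  | refl => exact hq
  | step _ ih => exact Or.inl ih

variable (P : Policy S)

/-- The universal player decreases the rank in every round. -/
theorem exists_universal_strategy {k : ℕ} (h : UWin D k D.start) :
    Team.universal.HasForcedWin D P := by
  classical
  let A : Q → ℕ → Prop := fun q k => ∃ b, ∀ m, UWin D k (nxt D q b m)
  -- In every state, the player takes a move to states of least possible rank.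
  have hA : ∀ q, ∃ b : Fin 2 → Bool, ∀ k, A q k → ∀ m, UWin D k (nxt D q b m) := by
    intro q
    by_cases hq : ∃ k, A q k
    · obtain ⟨b, hb⟩ := Nat.find_spec hq
      exact ⟨b, fun k hk m => (hb m).mono D (Nat.find_min' hq hk)⟩
    · exact ⟨fun _ => false, fun k hk => absurd ⟨k, hk⟩ hq⟩
  choose f hf using hA
  refine ⟨fun q _ => f q, fun s => ?_⟩
  have main : ∀ k t, UWin D k (position D P s (fun q _ => f q) t).state →
      (∀ j < t, (position D P s (fun q _ => f q) j).state ∉ D.accept) →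
      Team.universal.Wins D P s fun q _ => f q := by
    intro k
    induction k with
    | zero => exact fun t ht hj => ⟨t, ht.1, ht.2, hj⟩
    | succ k ih =>
      intro t ht hj
      rcases ht with ht | ⟨hacc, hA⟩
      · exact ih t ht hj
      · refine ih (t + 1) (hf _ k hA _) fun j hjt => ?_
        rcases Nat.lt_succ_iff_lt_or_eq.1 hjt with h | rfl
        · exact hj j h
        · exact hacc
  exact main k 0 h fun j hj => absurd hj (Nat.not_lt_zero j)

/-- Outside the states won by the universal player, the existential players can reply to any given
strategy of the universal player by moves fixed in advance. -/
theorem uWin_of_universal (h : Team.universal.HasForcedWin D P) : ∃ k, UWin D k D.start := by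
  obtain ⟨a, ha⟩ := h
  by_contra hstart
  have hreply : ∀ q b, ∃ m, (¬∃ k, UWin D k q) → q ∉ D.accept → ¬∃ k, UWin D k (nxt D q b m) := by
    intro q b
    by_cases hq : (¬∃ k, UWin D k q) ∧ q ∉ D.accept
    · by_contra! hc
      choose k hk using fun m => (hc m).2.2
      refine hq.1 ⟨Finset.univ.sup k + 1, Or.inr ⟨hq.2, b, fun m => ?_⟩⟩
      exact (hk m).mono D (Finset.le_sup (Finset.mem_univ m))
    · exact ⟨fun _ => false, fun h₁ h₂ => absurd ⟨h₁, h₂⟩ hq⟩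
  choose r hr using hreply
  let reply : Position Q S → Round Q := fun x =>
    { state := x.state, bit := a x.state x.past, move := r x.state (a x.state x.past)
      midMsg := fun i => List.ofFn fun _ : Fin (P.mid x.policyState i) => false
      finMsg := fun i => List.ofFn fun _ : Fin (P.fin x.policyState i) => false }
  let pos : ℕ → Position Q S := fun n =>
    Nat.rec ⟨D.start, P.start, []⟩ (fun _ x => advance D P x (reply x)) n
  have hlen : ∀ n, (pos n).past.length = n := by
    intro n
    induction n with
    | zero => rfl
    | succ n ih => exact congrArg (· + 1) ih
  -- The number of a round is known from the number of past observations.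
  let s : Fin 2 → EStrategy := fun i =>
    { mid := fun _ _ _ _ => false
      move := fun o _ _ => (reply (pos o.length)).move i
      fin := fun _ _ _ _ _ => false }
  have hpos : ∀ n, position D P s a n = pos n := by
    intro n
    induction n with
    | zero => rfl
    | succ n ih =>
      show advance D P (position D P s a n) _ = advance D P (pos n) (reply (pos n))
      rw [ih]
      congr 1
      have : ∀ i, (view i (pos n).past).length = n := fun i => by simp [view, hlen]
      simp only [playRound, s, this]
      rfl
  have hsafe : ∀ n, (∀ j < n, (pos j).state ∉ D.accept) → ¬∃ k, UWin D k (pos n).state := by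
    intro n
    induction n with
    | zero => exact fun _ => hstart
    | succ n ih =>
      exact fun hn => hr _ _ (ih fun j hj => hn j (by omega)) (hn n n.lt_succ_self)
  obtain ⟨k, h₁, h₂, h₃⟩ := ha s
  simp only [hpos] at h₁ h₂ h₃
  exact hsafe k h₃ ⟨0, h₁, h₂⟩

/-! ### The existential team -/

/-- The pair with value `x` at `i` and `y` at the other index. -/
def pair (i : Fin 2) (x y : Bool) : Fin 2 → Bool := fun j => if j = i then x else y

theorem pair_eta (i : Fin 2) (b : Fin 2 → Bool) : pair i (b i) (b (1 - i)) = b := by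
  funext j
  revert i j
  decide +revert

theorem pair_self (i : Fin 2) (x y : Bool) : pair i x y i = x := if_pos rfl

theorem one_sub_ne (i : Fin 2) : 1 - i ≠ i := by
  revert i
  decide

theorem one_sub_one_sub (i : Fin 2) : 1 - (1 - i) = i := by
  revert i
  decide

/-- After the bit `b` and the move `m` of `∃ᵢ`, the informed player can lead each state of `A`
that is not yet won into `B`, and no state of `A` is lost. -/
def Good (i : Fin 2) (A : Set Q) (b m : Bool) (B : Set Q) : Prop :=
  ∀ q ∈ A, q ∈ D.winE ∨ q ∉ D.winA ∧ ∀ c, ∃ m', nxt D q (pair i b c) (pair i m m') ∈ B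

/-- The existential team wins within `k` rounds if `∃ᵢ`, who learns its own bits only, knows that
the present state is in `A`, and its teammate is informed of all bits. -/
def EWin (i : Fin 2) : ℕ → Set Q → Prop
  | 0, A => A = ∅
  | k + 1, A => ∀ b, ∃ m B, EWin i k B ∧ Good D i A b m B

theorem EWin.mono {i : Fin 2} {k l : ℕ} (h : k ≤ l) {A : Set Q} (hA : EWin D i k A) :
    EWin D i l A := by
  have hempty : ∀ k, EWin D i k (∅ : Set Q) := by
    intro k
    induction k with
    | zero => rfl
    | succ k ih => exact fun b => ⟨false, ∅, ih, fun q hq => absurd hq (Set.notMem_empty q)⟩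
  have step : ∀ k A, EWin D i k A → EWin D i (k + 1) A := by
    intro k
    induction k with
    | zero =>
      intro A hA
      rw [show A = ∅ from hA]
      exact hempty 1
    | succ k ih =>
      intro A hA b
      obtain ⟨m, B, hB, hg⟩ := hA b
      exact ⟨m, B, ih B hB, hg⟩
  induction h with
  | refl => exact hA
  | step _ ih => exact step _ _ ih

/-- The sender `∃ᵢ` forwards its bits, and both players move from sets to sets of lower rank. -/
theorem existential_of_eWin {i : Fin 2} {K : ℕ} (hK : EWin D i K {D.start})
    (hP : ∀ p, 1 ≤ P.mid p i) : Team.existential.HasForcedWin D P := by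
  classical
  have hchoice : ∀ k (A : Set Q) b, ∃ m B,
      EWin D i (k + 1) A → EWin D i k B ∧ Good D i A b m B := by
    intro k A b
    by_cases h : EWin D i (k + 1) A
    · obtain ⟨m, B, hB⟩ := h b
      exact ⟨m, B, fun _ => hB⟩
    · exact ⟨false, ∅, fun h' => absurd h' h⟩
  choose f F hfF using hchoice
  -- What `∃ᵢ` knows about the state, as a function of the bits that it has learned.
  let bel : List Bool → Set Q := fun h =>
    List.rec {D.start} (fun b h A => F (K - (h.length + 1)) A b) h
  let mv : List Bool → Bool → Bool := fun h b => f (K - (h.length + 1)) (bel h) b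
  have hbel : ∀ h : List Bool, h.length ≤ K → EWin D i (K - h.length) (bel h) := by
    intro h
    induction h with
    | nil => exact fun _ => hK
    | cons b h ih =>
      intro hl
      have hl : h.length + 1 ≤ K := hl
      have := ih (by omega)
      rw [show K - h.length = K - (h.length + 1) + 1 by omega] at this
      exact (hfF _ _ b this).1
  have hgood : ∀ (h : List Bool) (b : Bool), h.length < K →
      Good D i (bel h) b (mv h b) (bel (b :: h)) := by
    intro h b hl
    have := hbel h hl.le
    rw [show K - h.length = K - (h.length + 1) + 1 by omega] at this
    exact (hfF _ _ b this).2
  have hanswer : ∀ (h : List Bool) (b c : Bool) (q : Q), ∃ m',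
      (∃ m', nxt D q (pair i b c) (pair i (mv h b) m') ∈ bel (b :: h)) →
      nxt D q (pair i b c) (pair i (mv h b) m') ∈ bel (b :: h) := by
    intro h b c q
    by_cases hm : ∃ m', nxt D q (pair i b c) (pair i (mv h b) m') ∈ bel (b :: h)
    · exact ⟨hm.choose, fun _ => hm.choose_spec⟩
    · exact ⟨false, fun h' => absurd h' hm⟩
  choose g hg using hanswer
  -- The informed player computes the state from the bits of both players.
  let st : List (Bool × Bool) → Q := fun H => List.rec D.start (fun x H q =>
    nxt D q (pair i x.1 x.2) (pair i (mv (H.map Prod.fst) x.1)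
      (g (H.map Prod.fst) x.1 x.2 q))) H
  let s : Fin 2 → EStrategy := fun j => if j = i then
    { mid := fun _ b _ _ => b
      move := fun o b _ => mv (o.map Obs.bit) b
      fin := fun _ _ _ _ _ => false }
    else
    { mid := fun _ _ _ _ => false
      move := fun o c t =>
        let H := o.map fun r => (r.midRecv.head?.getD false, r.bit)
        g (H.map Prod.fst) (t.head?.getD false) c (st H)
      fin := fun _ _ _ _ _ => false }
  refine ⟨s, fun a => ?_⟩
  set x := position D P s a with hx
  -- The bits of both players in the first `t` rounds, as the informed player learns them.
  let H : ℕ → List (Bool × Bool) := fun t =>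
    (x t).past.map fun r => (r.midMsg i |>.head?.getD false, r.bit (1 - i))
  have hmsg : ∀ t, ((playRound P s a (x t)).midMsg i).head? =
      some ((playRound P s a (x t)).bit i) := by
    intro t
    simp only [playRound, s, if_true]
    obtain ⟨k, hk⟩ := Nat.exists_eq_add_of_le' (hP (x t).policyState)
    rw [List.head?_eq_getElem?]
    simp [hk]
  have hH : ∀ t, H (t + 1) = ((playRound P s a (x t)).bit i,
      (playRound P s a (x t)).bit (1 - i)) :: H t := by
    intro t
    show (_, _) :: _ = _
    rw [hmsg]
    rfl
  have hbit : ∀ t, (view i (x t).past).map Obs.bit = (H t).map Prod.fst := by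
    intro t
    induction t with
    | zero => rfl
    | succ t ih =>
      rw [hH, List.map_cons, ← ih]
      rfl
  have hview : ∀ t, (view (1 - i) (x t).past).map
      (fun r => (r.midRecv.head?.getD false, r.bit)) = H t := by
    intro t
    simp only [view, List.map_map, H]
    refine List.map_congr_left fun r _ => ?_
    simp
  have hmv : ∀ t, (playRound P s a (x t)).move i =
      mv ((H t).map Prod.fst) ((playRound P s a (x t)).bit i) := by
    intro t
    rw [← hbit]
    simp [playRound, s]
  have hmv' : ∀ t, (playRound P s a (x t)).move (1 - i) =
      g ((H t).map Prod.fst) ((playRound P s a (x t)).bit i)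
        ((playRound P s a (x t)).bit (1 - i)) (st (H t)) := by
    intro t
    have h₁ : (playRound P s a (x t)).move (1 - i) = (s (1 - i)).move (view (1 - i) (x t).past)
        ((playRound P s a (x t)).bit (1 - i))
        ((playRound P s a (x t)).midMsg (1 - (1 - i))) := rfl
    have h₂ : (s (1 - i)).move = fun o c t =>
        let H := o.map fun r => (r.midRecv.head?.getD false, r.bit)
        g (H.map Prod.fst) (t.head?.getD false) c (st H) := by
      simp only [s, if_neg (one_sub_ne i)]
    rw [h₁, h₂]
    simp only [hview, one_sub_one_sub, hmsg, Option.getD_some]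
  have hlen : ∀ t, (H t).length = t := by
    intro t
    induction t with
    | zero => rfl
    | succ t ih => rw [hH, List.length_cons, ih]
  have hnext : ∀ t, (x (t + 1)).state = nxt D (x t).state
      (pair i ((playRound P s a (x t)).bit i) ((playRound P s a (x t)).bit (1 - i)))
      (pair i ((playRound P s a (x t)).move i) ((playRound P s a (x t)).move (1 - i))) := by
    intro t
    rw [pair_eta, pair_eta]
    rfl
  have hst : ∀ t, (x t).state = st (H t) := by
    intro t
    induction t with
    | zero => rfl
    | succ t ih =>
      rw [hnext, hmv, hmv', hH, ih]
  have hmem : ∀ t ≤ K, (∀ j < t, (x j).state ∉ D.accept) →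
      (x t).state ∈ bel ((H t).map Prod.fst) := by
    intro t
    induction t with
    | zero => exact fun _ _ => rfl
    | succ t ih =>
      intro ht hj
      have hq := ih (by omega) fun j h => hj j (by omega)
      have hacc := hj t t.lt_succ_self
      rw [mem_accept, not_or] at hacc
      have := (hgood ((H t).map Prod.fst) ((playRound P s a (x t)).bit i) (by simp [hlen]; omega)
        _ hq).resolve_left hacc.1
      have := hg _ _ _ _ (this.2 ((playRound P s a (x t)).bit (1 - i)))
      rw [hnext, hmv, hmv', ← hst, hH]
      exact this
  have hex : ∃ t < K, (x t).state ∈ D.accept := by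
    by_contra! hc
    have h₁ := hmem K le_rfl hc
    have h₂ := hbel ((H K).map Prod.fst) (by simp [hlen])
    rw [List.length_map, hlen, Nat.sub_self] at h₂
    rw [show bel ((H K).map Prod.fst) = ∅ from h₂] at h₁
    exact h₁
  have hex' : ∃ t, (x t).state ∈ D.accept := let ⟨t, _, ht⟩ := hex; ⟨t, ht⟩
  set t := Nat.find hex' with ht
  have htK : t < K := by
    obtain ⟨t', h₁, h₂⟩ := hex
    exact (Nat.find_min' hex' h₂).trans_lt h₁
  have hmin : ∀ j < t, (x j).state ∉ D.accept := fun j hj => Nat.find_min hex' hj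
  refine ⟨t, ?_, hmin⟩
  have hq := hmem t htK.le hmin
  rcases hgood ((H t).map Prod.fst) false (by simpa [hlen] using htK) _ hq with h | h
  · exact h
  · exact ((mem_accept D).1 (Nat.find_spec hex')).resolve_right h.1

section finite_horizon

variable {D P} {s : Fin 2 → EStrategy}

/-- The strategy of the universal player that inputs given bits. -/
def blind (β : ℕ → Fin 2 → Bool) : AStrategy Q := fun _ past => β past.length

theorem length_past (a : AStrategy Q) (k : ℕ) : (position D P s a k).past.length = k := by
  induction k with
  | zero => rfl
  | succ k ih => exact congrArg (· + 1) ih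

theorem position_blind_succ (β : ℕ → Fin 2 → Bool) (k : ℕ) :
    position D P s (blind β) (k + 1) = advance D P (position D P s (blind β) k)
      (playRound P s (fun _ _ => β k) (position D P s (blind β) k)) := by
  have : blind β (position D P s (blind β) k).state (position D P s (blind β) k).past = β k := by
    rw [blind, length_past]
  show advance D P _ (playRound P s (blind β) _) = _
  simp only [playRound, this]

theorem position_congr {β β' : ℕ → Fin 2 → Bool} {k : ℕ} (h : ∀ j < k, β j = β' j) :
    position D P s (blind β) k = position D P s (blind β') k := by
  induction k with
  | zero => rfl
  | succ k ih =>
    rw [position_blind_succ, position_blind_succ, ih fun j hj => h j (by omega),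
      h k k.lt_succ_self]

/-- A winning team wins within a bounded number of rounds, by compactness of the space of sequences
of bits of the universal player. -/
theorem exists_horizon (hs : ∀ a, Team.existential.Wins D P s a) :
    ∃ K, ∀ β, ∃ k < K, (position D P s (blind β) k).state ∈ D.winE := by
  let U : ℕ → Set (ℕ → Fin 2 → Bool) := fun K =>
    {β | ∃ k < K, (position D P s (blind β) k).state ∈ D.winE}
  have hopen : ∀ K, IsOpen (U K) := by
    intro K
    rw [isOpen_iff_forall_mem_open]
    intro β hβ
    refine ⟨⋂ j ∈ Finset.range K, {β' | β' j = β j}, ?_, ?_, ?_⟩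
    · intro β' hβ'
      simp only [Set.mem_iInter, Finset.mem_range, Set.mem_ofPred_eq] at hβ'
      obtain ⟨k, hk, h⟩ := hβ
      exact ⟨k, hk, by rwa [position_congr fun j hj => hβ' j (by omega)]⟩
    · exact isOpen_biInter_finset fun j _ =>
        (isOpen_discrete ({β j} : Set (Fin 2 → Bool))).preimage
          (continuous_apply (A := fun _ : ℕ => Fin 2 → Bool) j)
    · simp
  have hmono : Directed (· ⊆ ·) U := by
    intro K L
    exact ⟨max K L, fun β ⟨k, hk, h⟩ => ⟨k, hk.trans_le (le_max_left _ _), h⟩,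
      fun β ⟨k, hk, h⟩ => ⟨k, hk.trans_le (le_max_right _ _), h⟩⟩
  obtain ⟨K, hK⟩ := isCompact_univ.elim_directed_cover U hopen (fun β _ => by
    obtain ⟨k, hk, -⟩ := hs (blind β)
    exact Set.mem_iUnion.2 ⟨k + 1, k, k.lt_succ_self, hk⟩) hmono
  exact ⟨K, fun β => hK (Set.mem_univ β)⟩

/-- The sets of states that are possible under winning strategies, for given bits of the sender,
have ranks that count down from the horizon. -/
theorem eWin_of_existential {i : Fin 2} (hP : ∀ p, P.mid p (1 - i) = 0 ∧ P.fin p (1 - i) = 0)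
    (h : Team.existential.HasForcedWin D P) : ∃ K, EWin D i K {D.start} := by
  obtain ⟨s, hs⟩ := h
  obtain ⟨K, hK⟩ := exists_horizon hs
  have hsilent : ∀ a (x : Position Q S), (playRound P s a x).midMsg (1 - i) = [] ∧
      (playRound P s a x).finMsg (1 - i) = [] := fun a x =>
    ⟨List.eq_nil_of_length_eq_zero (by simp [playRound, (hP x.policyState).1]),
      List.eq_nil_of_length_eq_zero (by simp [playRound, (hP x.policyState).2])⟩
  have hview : ∀ β k, view i (position D P s (blind β) k).past =
      ((position D P s (blind β) k).past.map fun r => r.bit i).map fun b => ⟨b, [], []⟩ := by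
    intro β k
    induction k with
    | zero => rfl
    | succ k ih =>
      rw [position_blind_succ]
      have hs := hsilent (fun _ _ => β k) (position D P s (blind β) k)
      show Obs.mk _ _ _ :: view i (position D P s (blind β) k).past = _ :: _
      rw [hs.1, hs.2, ih]
  -- The states in which the game can still be after given bits of `∃ᵢ`.
  let bel : List Bool → Set Q := fun h => {q | ∃ β,
    ((position D P s (blind β) h.length).past.map fun r => r.bit i) = h ∧
    (∀ j < h.length, (position D P s (blind β) j).state ∉ D.accept) ∧
    (position D P s (blind β) h.length).state = q}
  have hwin : ∀ k h, h.length + k = K → EWin D i k (bel h) := by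
    intro k
    induction k with
    | zero =>
      intro h hl
      refine Set.eq_empty_of_forall_notMem fun q ⟨β, _, hacc, _⟩ => ?_
      obtain ⟨k, hk, hE⟩ := hK β
      exact hacc k (by omega) ((mem_accept D).2 (Or.inl hE))
    | succ k ih =>
      intro h hl b
      refine ⟨(s i).move (h.map fun b => ⟨b, [], []⟩) b [], bel (b :: h),
        ih _ (by simp; omega), ?_⟩
      rintro q ⟨β, hpast, hacc, rfl⟩
      by_cases hE : (position D P s (blind β) h.length).state ∈ D.winE
      · exact Or.inl hE
      have hA : (position D P s (blind β) h.length).state ∉ D.winA := fun hA => by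
        obtain ⟨t, ht, hmin⟩ := hs (blind β)
        rcases lt_trichotomy t h.length with hlt | heq | hgt
        · exact hacc t hlt ((mem_accept D).2 (Or.inl ht))
        · exact hE (heq ▸ ht)
        · exact hmin _ hgt ((mem_accept D).2 (Or.inr hA))
      refine Or.inr ⟨hA, fun c => ?_⟩
      set β' := Function.update β h.length (pair i b c) with hβ'
      have hpos : ∀ j ≤ h.length, position D P s (blind β') j = position D P s (blind β) j :=
        fun j hj => position_congr fun l hl => Function.update_of_ne (by omega) _ _
      have hsucc := position_blind_succ (D := D) (P := P) (s := s) β' h.length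
      rw [hpos _ le_rfl, hβ', Function.update_self, ← hβ'] at hsucc
      set x := position D P s (blind β) h.length with hx
      set ρ := playRound P s (fun _ _ => pair i b c) x with hρ
      have hbi : ρ.bit i = b := pair_self i b c
      refine ⟨ρ.move (1 - i), β', ?_, ?_, ?_⟩
      · rw [List.length_cons, hsucc]
        show ρ.bit i :: _ = _
        rw [hbi, hpast]
      · intro j hj
        rcases Nat.lt_succ_iff_lt_or_eq.1 hj with hj | rfl
        · rw [hpos j hj.le]
          exact hacc j hj
        · rw [hpos _ le_rfl, mem_accept, not_or]
          exact ⟨hE, hA⟩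
      · rw [List.length_cons, hsucc]
        have hmove : ρ.move i = (s i).move (h.map fun b => ⟨b, [], []⟩) b [] := by
          have h₁ : ρ.move i = (s i).move (view i x.past) (ρ.bit i) (ρ.midMsg (1 - i)) := rfl
          rw [h₁, hbi, hρ, (hsilent (fun _ _ => pair i b c) x).1, hx, hview, hpast]
        rw [← hmove, pair_eta]
        rfl
  refine ⟨K, ?_⟩
  have := hwin K [] (by simp)
  rwa [show bel [] = {D.start} from Set.ext fun q => ⟨fun ⟨_, _, _, hq⟩ => hq.symm,
    fun hq => ⟨fun _ _ => false, rfl, fun j hj => absurd hj (Nat.not_lt_zero j), hq.symm⟩⟩] at this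

end finite_horizon

end game

open StackProg

/-! ### The encoding of a game in arithmetic -/

section encoding

variable {α : Type} [Ctx α]

/-- Binary digits are written from the least significant one. -/
theorem encodeNat_of_pos {k : ℕ} (hk : 0 < k) :
    Computability.encodeNat k = decide (k % 2 = 1) :: Computability.encodeNat (k / 2) := by
  have hcast : ∀ m : Num, Computability.encodeNat (m : ℕ) = Computability.encodeNum m := fun m =>
    congrArg Computability.encodeNum (Num.of_to_nat m)
  obtain ⟨m, rfl⟩ : ∃ m : Num, (m : ℕ) = k := ⟨k, Num.to_of_nat k⟩
  rcases m with _ | _ | p | p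
  · exact absurd hk (lt_irrefl _)
  · rfl
  · have h : ((Num.pos p.bit1 : Num) : ℕ) = 2 * ((Num.pos p : Num) : ℕ) + 1 := by
      show (p : ℕ) + p + 1 = 2 * (p : ℕ) + 1
      omega
    rw [hcast, h, show (2 * ((Num.pos p : Num) : ℕ) + 1) / 2 = ((Num.pos p : Num) : ℕ) by omega,
      hcast]
    simp [Computability.encodeNum, Computability.encodePosNum]
  · have h : ((Num.pos p.bit0 : Num) : ℕ) = 2 * ((Num.pos p : Num) : ℕ) := by
      show (p : ℕ) + p = 2 * (p : ℕ)
      omega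
    rw [hcast, h, show (2 * ((Num.pos p : Num) : ℕ)) / 2 = ((Num.pos p : Num) : ℕ) by omega,
      hcast]
    simp [Computability.encodeNum, Computability.encodePosNum]

/-- Put the code of the number `k` in front of the word with number `r`. Numbers of words are
truncated at `C`, which keeps them linear in the arguments. -/
def prependNat (C k r : ℕ) : ℕ :=
  Nat.rec (motive := fun _ => ℕ) (min (r + r + r + 3) C) (fun t a =>
    if k / 2 ^ (k - 1 - t) = 0 then a else min (a + a + a + 1 + k / 2 ^ (k - 1 - t) % 2) C) k

/-- The digits of `k` are put in front from the most significant one, that of index `k - 1`;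
leading zeros are skipped. -/
theorem prependNat_eq (C k : ℕ) (w : List (Option Bool)) : prependNat C k (min (val w) C) =
    min (val ((Computability.encodeNat k).map some ++ none :: w)) C := by
  have h : ∀ t ≤ k, Nat.rec (motive := fun _ => ℕ)
      (min (min (val w) C + min (val w) C + min (val w) C + 3) C) (fun t a =>
      if k / 2 ^ (k - 1 - t) = 0 then a else min (a + a + a + 1 + k / 2 ^ (k - 1 - t) % 2) C) t =
      min (val ((Computability.encodeNat (k / 2 ^ (k - t))).map some ++ none :: w)) C := by
    intro t
    induction t with
    | zero =>
      intro _
      rw [Nat.sub_zero, Nat.div_eq_of_lt Nat.lt_two_pow_self]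
      show _ = min (3 * val w + 3) C
      show min (_ + 3) C = _
      omega
    | succ t ih =>
      intro ht
      have hk : k - t = k - 1 - t + 1 := by omega
      have hk' : k - (t + 1) = k - 1 - t := by omega
      show (if _ then _ else _) = _
      rw [ih (by omega), hk, hk', pow_succ, ← Nat.div_div_eq_div_mul]
      set u := k / 2 ^ (k - 1 - t)
      split_ifs with hu
      · rw [hu]
      · rw [encodeNat_of_pos (Nat.pos_of_ne_zero hu), List.map_cons, List.cons_append]
        generalize hv : val (List.map some (Computability.encodeNat (u / 2)) ++ none :: w) = v
        rcases Nat.mod_two_eq_zero_or_one u with h | h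
        · rw [h, show decide (0 = 1) = false from rfl, val, hv]
          show min (_ + 0) C = min (3 * v + 1) C
          omega
        · rw [h, show decide (1 = 1) = true from rfl, val, hv]
          show min (_ + 1) C = min (3 * v + 2) C
          omega
  have := h k le_rfl
  rw [Nat.sub_self, pow_zero, Nat.div_one] at this
  exact this

/-- All intermediate values in the computation of `prependNat` are truncated. -/
theorem prependNat_rec_le (C k r t : ℕ) : Nat.rec (motive := fun _ => ℕ) (min (r + r + r + 3) C)
    (fun t a => if k / 2 ^ (k - 1 - t) = 0 then a else
      min (a + a + a + 1 + k / 2 ^ (k - 1 - t) % 2) C) t ≤ C := by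
  induction t with
  | zero => exact Nat.min_le_right _ _
  | succ t ih =>
    show (if _ then _ else _) ≤ _
    split_ifs
    · exact ih
    · exact Nat.min_le_right _ _

theorem _root_.StackProg.Tame.min {f g : α → ℕ} (hf : Tame f) (hg : Tame g) :
    Tame fun x => min (f x) (g x) := by
  have := Tame.ite (TameP.le hf hg) hf hg
  exact this

theorem _root_.StackProg.Tame.prependNat {C k r : α → ℕ} (hC : Tame C) (hk : Tame k)
    (hr : Tame r) : Tame fun x => prependNat (C x) (k x) (r x) := by
  have hu : Tame fun y : (α × ℕ) × ℕ => k y.1.1 / 2 ^ (k y.1.1 - 1 - y.1.2) :=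
    (hk.fst.fst).div_pow (Tame.const 2) (hk.fst.fst.pred.sub Tame.snd.fst)
  refine Tame.prec (s := fun x t a => if k x / 2 ^ (k x - 1 - t) = 0 then a else
    Min.min (a + a + a + 1 + k x / 2 ^ (k x - 1 - t) % 2) (C x)) hk
    ((((hr.add hr).add hr).add (Tame.const 3)).min hC)
    (Tame.ite (TameP.eq_zero hu) Tame.snd (((((Tame.snd.add Tame.snd).add Tame.snd).succ).add
      (hu.mod (Tame.const 2))).min hC.fst.fst)) hC.linBdd fun x t _ => prependNat_rec_le _ _ _ t

/-- The entry with index `j` of the table `G`, which consists of numbers up to `n + 1`. -/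
def ent (n G j : ℕ) : ℕ := dig (n + 2) G j

theorem _root_.StackProg.Tame.ent {n G j : α → ℕ} (hn : Tame n) (hG : Tame G) (hj : Tame j) :
    Tame fun x => ent (n x) (G x) (j x) :=
  Tame.dig hn.succ.succ hG hj

/-- The number of the word that encodes the first `m` entries of a table, truncated at `C`. -/
def wordNum (C n G m : ℕ) : ℕ :=
  Nat.rec (motive := fun _ => ℕ) 0 (fun t a => prependNat C (ent n G (m - 1 - t)) a) m

theorem wordNum_eq (C n G m : ℕ) :
    wordNum C n G m = min (val (encodeNats ((List.range m).map (ent n G)))) C := by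
  have h : ∀ t ≤ m, Nat.rec (motive := fun _ => ℕ) 0
      (fun t a => prependNat C (ent n G (m - 1 - t)) a) t =
      min (val (encodeNats ((List.range' (m - t) t).map (ent n G)))) C := by
    intro t
    induction t with
    | zero => exact fun _ => (Nat.zero_min C).symm
    | succ t ih =>
      intro ht
      show prependNat C _ _ = _
      rw [ih (by omega), prependNat_eq, List.range'_succ, List.map_cons,
        show m - 1 - t = m - (t + 1) by omega, show m - (t + 1) + 1 = m - t by omega]
      simp [encodeNats]
  have := h m le_rfl
  rw [Nat.sub_self, ← List.range_eq_range'] at this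
  exact this

theorem _root_.StackProg.Tame.wordNum {C n G m : α → ℕ} (hC : Tame C) (hn : Tame n)
    (hG : Tame G) (hm : Tame m) : Tame fun x => wordNum (C x) (n x) (G x) (m x) := by
  refine Tame.prec (s := fun x t a => TDGCSolution.prependNat (C x)
    (TDGCSolution.ent (n x) (G x) (m x - 1 - t)) a)
    hm (Tame.const 0) (Tame.prependNat hC.fst.fst (Tame.ent hn.fst.fst hG.fst.fst
      (hm.fst.fst.pred.sub Tame.snd.fst)) Tame.snd) hC.linBdd fun x t _ => ?_
  cases t with
  | zero => exact Nat.zero_le _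
  | succ t => exact prependNat_rec_le _ _ _ _

/-- The table entry with the successor of the state `q`. -/
def tStep (n G q : ℕ) (b : Bool) : ℕ := ent n G (2 + (q + q + b.toNat))

/-- The state after a round, computed from the table. -/
def tNxt (n G q : ℕ) (b m : Fin 2 → Bool) : ℕ :=
  tStep n G (tStep n G (tStep n G (tStep n G q (b 0)) (b 1)) (m 0)) (m 1)

/-- The state `q` is in `F_∃` according to the table. -/
def TWinE (n G q : ℕ) : Prop := ent n G (2 + (n + n + q)) = 1

/-- The state `q` is in `F_∀` according to the table. -/
def TWinA (n G q : ℕ) : Prop := ent n G (2 + (n + n + (n + q))) = 1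

/-- The element `q` belongs to the set that is coded by the binary digits of `A`. -/
def Mem (q A : ℕ) : Prop := dig 2 A q = 1

/-- The entries are those of a table with `n` states. -/
def ValidTable (n G : ℕ) : Prop :=
  ent n G 0 = n ∧ ent n G 1 < n ∧ (∀ j < n + n, ent n G (2 + j) < n) ∧
    ∀ j < n + n, ent n G (2 + (n + n + j)) < 2

/-- The start state belongs to all sets of states that contain the states won by the universal
player at once and all states from which it can force the next state into the set. -/
def TUniversal (n G N : ℕ) : Prop :=
  ∀ T < N, (∀ q < n, (¬TWinE n G q ∧ (TWinA n G q ∨ ∃ b₀ b₁, ∀ m₀ m₁,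
    Mem (tNxt n G q ![b₀, b₁] ![m₀, m₁]) T)) → Mem q T) → Mem (ent n G 1) T

/-- The set of the start state belongs to all families of sets of states that contain the empty set
and all sets `A` that `∃ᵢ` and its informed teammate can lead to a set in the family. -/
def TExistential (i : Fin 2) (n G N : ℕ) : Prop :=
  ∀ X < N, (∀ A < N, A / 2 ^ n = 0 → ((∀ q < n, ¬Mem q A) ∨ ∀ b, ∃ m, ∃ B < N, B / 2 ^ n = 0 ∧
    Mem B X ∧ ∀ q < n, Mem q A → TWinE n G q ∨ ¬TWinA n G q ∧
      ∀ c, ∃ m', Mem (tNxt n G q (pair i b c) (pair i m m')) B) → Mem A X) →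
    ∀ A < N, A / 2 ^ n = 0 → (∀ q < n, (Mem q A → q = ent n G 1) ∧ (q = ent n G 1 → Mem q A)) →
      Mem A X

section tame

variable {n G N q A : α → ℕ}

theorem tame_tStep (hn : Tame n) (hG : Tame G) (hq : Tame q) (b : Bool) :
    Tame fun x => tStep (n x) (G x) (q x) b :=
  hn.ent hG ((Tame.const 2).add ((hq.add hq).add (Tame.const _)))

theorem tame_tNxt (hn : Tame n) (hG : Tame G) (hq : Tame q) (b m : Fin 2 → Bool) :
    Tame fun x => tNxt (n x) (G x) (q x) b m :=
  tame_tStep hn hG (tame_tStep hn hG (tame_tStep hn hG (tame_tStep hn hG hq _) _) _) _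

theorem tameP_tWinE (hn : Tame n) (hG : Tame G) (hq : Tame q) :
    TameP fun x => TWinE (n x) (G x) (q x) :=
  TameP.eq (hn.ent hG ((Tame.const 2).add ((hn.add hn).add hq))) (Tame.const 1)

theorem tameP_tWinA (hn : Tame n) (hG : Tame G) (hq : Tame q) :
    TameP fun x => TWinA (n x) (G x) (q x) :=
  TameP.eq (hn.ent hG ((Tame.const 2).add ((hn.add hn).add (hn.add hq)))) (Tame.const 1)

theorem tameP_mem (hq : Tame q) (hA : Tame A) : TameP fun x => Mem (q x) (A x) :=
  TameP.eq ((Tame.const 2).dig hA hq) (Tame.const 1)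

theorem tameP_validTable (hn : Tame n) (hG : Tame G) :
    TameP fun x => ValidTable (n x) (G x) :=
  .and (.eq (hn.ent hG (Tame.const 0)) hn) <| .and (.lt (hn.ent hG (Tame.const 1)) hn) <|
    .and
      (.ball (hn.add hn) (.lt (hn.fst.ent hG.fst ((Tame.const 2).add Tame.snd)) hn.fst))
      (.ball (hn.add hn) (.lt (hn.fst.ent hG.fst ((Tame.const 2).add
        ((hn.fst.add hn.fst).add Tame.snd))) (Tame.const 2)))

theorem tameP_tUniversal (hn : Tame n) (hG : Tame G) (hN : Tame N) :
    TameP fun x => TUniversal (n x) (G x) (N x) :=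
  .ball hN <| .imp
    (.ball hn.fst <| .imp
      (.and (tameP_tWinE hn.fst.fst hG.fst.fst Tame.snd).not
        (.or (tameP_tWinA hn.fst.fst hG.fst.fst Tame.snd)
          (.exists_bool fun _ => .exists_bool fun _ => .forall_bool fun _ => .forall_bool fun _ =>
            tameP_mem (tame_tNxt hn.fst.fst hG.fst.fst Tame.snd _ _) Tame.snd.fst)))
      (tameP_mem Tame.snd Tame.snd.fst))
    (tameP_mem (hn.fst.ent hG.fst (Tame.const 1)) Tame.snd)

theorem tameP_tExistential (i : Fin 2) (hn : Tame n) (hG : Tame G) (hN : Tame N) :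
    TameP fun x => TExistential i (n x) (G x) (N x) := by
  have hdiv : ∀ {β : Type} [Ctx β] {n A : β → ℕ}, Tame n → Tame A →
      TameP fun x => A x / 2 ^ n x = 0 := fun hn hA =>
    .eq_zero (hA.div_pow (Tame.const 2) hn)
  refine .ball hN <| .imp (.ball hN.fst <| .imp (hdiv hn.fst.fst Tame.snd) <|
    .imp (.or ?_ ?_) ?_) ?_
  · exact .ball hn.fst.fst (tameP_mem Tame.snd Tame.snd.fst).not
  · refine .forall_bool fun _ => .exists_bool fun _ => .bex hN.fst.fst <|
      .and (hdiv hn.fst.fst.fst Tame.snd) <| .and (tameP_mem Tame.snd Tame.snd.fst.fst) <|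
      .ball hn.fst.fst.fst <| .imp (tameP_mem Tame.snd Tame.snd.fst.fst) <|
      .or (tameP_tWinE hn.fst.fst.fst.fst hG.fst.fst.fst.fst Tame.snd) <|
      .and (tameP_tWinA hn.fst.fst.fst.fst hG.fst.fst.fst.fst Tame.snd).not <|
      .forall_bool fun _ => .exists_bool fun _ =>
        tameP_mem (tame_tNxt hn.fst.fst.fst.fst hG.fst.fst.fst.fst Tame.snd _ _) Tame.snd.fst
  · exact tameP_mem Tame.snd Tame.snd.fst
  · refine .ball hN.fst <| .imp (hdiv hn.fst.fst Tame.snd) <| .imp ?_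
      (tameP_mem Tame.snd Tame.snd.fst)
    have hs : Tame fun x => ent (n x) (G x) 1 := hn.ent hG (Tame.const 1)
    refine .ball hn.fst.fst <| .and (.imp (tameP_mem Tame.snd Tame.snd.fst)
      (.eq Tame.snd hs.fst.fst.fst)) (.imp (.eq Tame.snd hs.fst.fst.fst)
        (tameP_mem Tame.snd Tame.snd.fst))

end tame

end encoding

/-! ### The table of a game automaton -/

section represents

variable {n : ℕ}

/-- The table `G` is that of the game automaton `D`. -/
structure Represents (G : ℕ) (D : GameDFA (Fin n)) : Prop where
  size : ent n G 0 = n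
  start : ent n G 1 = D.start
  step : ∀ (q : Fin n) b, tStep n G q b = D.step q b
  winE : ∀ q : Fin n, ent n G (2 + (n + n + q)) = ind (q ∈ D.winE)
  winA : ∀ q : Fin n, ent n G (2 + (n + n + (n + q))) = ind (q ∈ D.winA)

namespace Represents

variable {G : ℕ} {D : GameDFA (Fin n)}

theorem nxt_eq (h : Represents G D) (q : Fin n) (b m : Fin 2 → Bool) :
    tNxt n G q b m = nxt D q b m := by
  simp only [tNxt, h.step]
  rfl

theorem tWinE_iff (h : Represents G D) (q : Fin n) : TWinE n G q ↔ q ∈ D.winE := by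
  rw [TWinE, h.winE, ind_eq_one]

theorem tWinA_iff (h : Represents G D) (q : Fin n) : TWinA n G q ↔ q ∈ D.winA := by
  rw [TWinA, h.winA, ind_eq_one]

theorem valid (h : Represents G D) : ValidTable n G := by
  refine ⟨h.size, h.start ▸ D.start.2, fun j hj => ?_, fun j hj => ?_⟩
  · have : ent n G (2 + j) = tStep n G (j / 2) (decide (j % 2 = 1)) := by
      unfold tStep
      congr 2
      rcases Nat.mod_two_eq_zero_or_one j with h | h <;> simp [h] <;> omega
    rw [this, h.step ⟨j / 2, by omega⟩]
    exact Fin.is_lt _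
  · rcases Nat.lt_or_ge j n with hjn | hjn
    · rw [h.winE ⟨j, hjn⟩]
      exact Nat.lt_succ_of_le (ind_le_one _)
    · rw [show j = n + (j - n) by omega, h.winA ⟨j - n, by omega⟩]
      exact Nat.lt_succ_of_le (ind_le_one _)

theorem flatMap_pairs {β : Type} (g : ℕ → β) (n : ℕ) :
    (List.range n).flatMap (fun q => [g (q + q), g (q + q + 1)])
      = (List.range (n + n)).map g := by
  induction n with
  | zero => rfl
  | succ n ih =>
    rw [List.range_succ, List.flatMap_append, ih, show n + 1 + (n + 1) = n + n + 1 + 1 by omega,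
      List.range_succ, List.range_succ]
    simp

theorem encode_eq (h : Represents G D) :
    encodeGame D = encodeNats ((List.range (2 + (n + n + (n + n)))).map (ent n G)) := by
  have h₁ : (List.finRange n).flatMap (fun q => [(D.step q false : ℕ), (D.step q true : ℕ)]) =
      (List.range (n + n)).map fun j => ent n G (2 + j) := by
    rw [← flatMap_pairs, ← List.map_coe_finRange_eq_range, List.flatMap_map]
    refine List.flatMap_congr fun q _ => ?_
    rw [← h.step, ← h.step]
    rfl
  have h₂ : (List.finRange n).map (fun q => if q ∈ D.winE then 1 else 0) =
      (List.range n).map fun j => ent n G (2 + (n + n + j)) := by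
    rw [← List.map_coe_finRange_eq_range, List.map_map]
    refine List.map_congr_left fun q _ => ?_
    rw [Function.comp, h.winE, ind_ite]
  have h₃ : (List.finRange n).map (fun q => if q ∈ D.winA then 1 else 0) =
      (List.range n).map fun j => ent n G (2 + (n + n + (n + j))) := by
    rw [← List.map_coe_finRange_eq_range, List.map_map]
    refine List.map_congr_left fun q _ => ?_
    rw [Function.comp, h.winA, ind_ite]
  rw [encodeGame, h₁, h₂, h₃, List.range_add (n := 2), List.range_add (n := n + n),
    List.range_add (n := n) (m := n)]
  simp only [List.map_append, List.map_map, List.append_assoc]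
  rw [← h.start]
  nth_rewrite 1 [← h.size]
  rfl

/-- The attractor itself is one of the sets to be tested. -/
theorem tUniversal_iff (h : Represents G D) {N : ℕ} (hN : 2 ^ n ≤ N) :
    TUniversal n G N ↔ ∃ k, UWin D k D.start := by
  constructor
  · intro hT
    obtain ⟨T, hT₁, hT₂⟩ := exists_dig_eq two_pos n
      (fun q => ind (∃ hq : q < n, ∃ k, UWin D k ⟨q, hq⟩))
      fun q _ => Nat.lt_succ_of_le (ind_le_one _)
    have hmem : ∀ q : Fin n, Mem q T ↔ ∃ k, UWin D k q := by
      intro q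
      rw [Mem, hT₂ q q.2, ind_eq_one]
      exact ⟨fun ⟨_, h⟩ => h, fun h => ⟨q.2, h⟩⟩
    rw [← hmem, ← h.start]
    refine hT T (hT₁.trans_le hN) fun q hq hrule => ?_
    lift q to Fin n using hq
    rw [hmem]
    rw [h.tWinE_iff, h.tWinA_iff] at hrule
    obtain ⟨hE, hA⟩ := hrule
    by_cases hA' : q ∈ D.winA
    · exact ⟨0, hE, hA'⟩
    obtain ⟨b₀, b₁, hb⟩ := hA.resolve_left hA'
    simp only [h.nxt_eq, hmem] at hb
    have hb' : ∀ m, ∃ k, UWin D k (nxt D q ![b₀, b₁] m) := fun m => hb (m 0) (m 1)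
    choose k hk using hb'
    refine ⟨Finset.univ.sup k + 1, Or.inr ⟨?_, ![b₀, b₁], fun m => ?_⟩⟩
    · rw [mem_accept, not_or]
      exact ⟨hE, hA'⟩
    · exact (hk m).mono D (Finset.le_sup (Finset.mem_univ m))
  · rintro ⟨k, hk⟩ T - hrule
    have main : ∀ k (q : Fin n), UWin D k q → Mem q T := by
      intro k
      induction k with
      | zero =>
        intro q hq
        refine hrule q q.2 ?_
        rw [h.tWinE_iff, h.tWinA_iff]
        exact ⟨hq.1, Or.inl hq.2⟩
      | succ k ih =>
        rintro q (hq | ⟨hacc, b, hb⟩)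
        · exact ih q hq
        · rw [mem_accept, not_or] at hacc
          refine hrule q q.2 ?_
          rw [h.tWinE_iff]
          refine ⟨hacc.1, Or.inr ⟨b 0, b 1, fun m₀ m₁ => ?_⟩⟩
          rw [h.nxt_eq]
          exact ih _ (hb _)
    rw [h.start]
    exact main k _ hk

/-- The set of states coded by the binary digits of a number. -/
def setOf (n A : ℕ) : Set (Fin n) := {q | Mem q A}

theorem exists_setOf_eq (A : Set (Fin n)) : ∃ x < 2 ^ n, setOf n x = A := by
  obtain ⟨x, hx, hd⟩ := exists_dig_eq two_pos n (fun q => ind (∃ hq : q < n, ⟨q, hq⟩ ∈ A))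
    fun q _ => Nat.lt_succ_of_le (ind_le_one _)
  refine ⟨x, hx, Set.ext fun q => ?_⟩
  show dig 2 x q = 1 ↔ _
  rw [hd q q.2, ind_eq_one]
  exact ⟨fun ⟨_, h⟩ => h, fun h => ⟨q.2, h⟩⟩

/-- The attractor itself, restricted to the codes below `2 ^ n`, is one of the families to be
tested. -/
theorem tExistential_iff (h : Represents G D) (i : Fin 2) {N : ℕ} (hN : 2 ^ 2 ^ n ≤ N) :
    TExistential i n G N ↔ ∃ k, EWin D i k {D.start} := by
  have hN' : 2 ^ n ≤ N := Nat.lt_two_pow_self.le.trans hN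
  have hgood : ∀ (A B : ℕ) b m, (∀ q < n, Mem q A → TWinE n G q ∨ ¬TWinA n G q ∧
      ∀ c, ∃ m', Mem (tNxt n G q (pair i b c) (pair i m m')) B) ↔
      Good D i (setOf n A) b m (setOf n B) := by
    intro A B b m
    constructor
    · intro hq q hqA
      have := hq q q.2 hqA
      rw [h.tWinE_iff, h.tWinA_iff] at this
      simp only [h.nxt_eq] at this
      exact this
    · intro hg q hq hqA
      lift q to Fin n using hq
      rw [h.tWinE_iff, h.tWinA_iff]
      simp only [h.nxt_eq]
      exact hg q hqA
  constructor
  · intro hT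
    obtain ⟨X, hX, hd⟩ := exists_dig_eq two_pos (2 ^ n) (fun A => ind (∃ k, EWin D i k (setOf n A)))
      fun q _ => Nat.lt_succ_of_le (ind_le_one _)
    have hmem : ∀ A < 2 ^ n, Mem A X ↔ ∃ k, EWin D i k (setOf n A) := by
      intro A hA
      rw [Mem, hd A hA, ind_eq_one]
    have hlt : ∀ A, A / 2 ^ n = 0 → A < 2 ^ n := fun A hA =>
      (Nat.div_eq_zero_iff_lt (Nat.two_pow_pos n)).1 hA
    obtain ⟨A, hA, hset⟩ := exists_setOf_eq (n := n) {D.start}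
    rw [← hset, ← hmem A hA]
    refine hT X (hX.trans_le hN) (fun A _ hA hrule => ?_) A (hA.trans_le hN')
      (Nat.div_eq_of_lt hA) fun q hq => ?_
    · rw [hmem A (hlt A hA)]
      rcases hrule with hrule | hrule
      · exact ⟨0, Set.eq_empty_of_forall_notMem fun q => hrule q q.2⟩
      · choose m B _ hB hBX hg using hrule
        choose k hk using fun b => (hmem (B b) (hlt _ (hB b))).1 (hBX b)
        refine ⟨Finset.univ.sup k + 1, fun b => ⟨m b, setOf n (B b), ?_, (hgood _ _ _ _).1 (hg b)⟩⟩
        exact (hk b).mono D (Finset.le_sup (Finset.mem_univ b))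
    · lift q to Fin n using hq
      have : Mem q A ↔ q = D.start := by
        rw [← Set.mem_singleton_iff, ← hset]
        rfl
      rw [h.start, this, Fin.val_inj]
      exact ⟨id, id⟩
  · rintro ⟨k, hk⟩ X - hrule A hA hA' hstart
    have main : ∀ k A, A < N → A / 2 ^ n = 0 → EWin D i k (setOf n A) → Mem A X := by
      intro k
      induction k with
      | zero =>
        intro A hA hA' he
        refine hrule A hA hA' (Or.inl fun q hq hqA => ?_)
        have : (⟨q, hq⟩ : Fin n) ∈ setOf n A := hqA
        rw [show setOf n A = ∅ from he] at this
        exact this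
      | succ k ih =>
        intro A hA hA' hw
        refine hrule A hA hA' (Or.inr fun b => ?_)
        obtain ⟨m, B', hB', hg⟩ := hw b
        obtain ⟨B, hB, rfl⟩ := exists_setOf_eq B'
        have hdiv := Nat.div_eq_of_lt hB
        exact ⟨m, B, hB.trans_le hN', hdiv, ih B (hB.trans_le hN') hdiv hB', (hgood _ _ _ _).2 hg⟩
    refine main k A hA hA' ?_
    rwa [show setOf n A = {D.start} from ?_]
    ext q
    rw [Set.mem_singleton_iff]
    have := hstart q q.2
    rw [h.start, Fin.val_inj] at this
    exact ⟨this.1, this.2⟩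

end Represents

theorem exists_represents_of_valid {G : ℕ} (h : ValidTable n G) :
    ∃ D : GameDFA (Fin n), Represents G D := by
  classical
  obtain ⟨h₀, h₁, h₂, h₃⟩ := h
  have hlt : ∀ (q : Fin n) (b : Bool), tStep n G q b < n := fun q b =>
    h₂ _ (by have := b.toNat_le; omega)
  let D : GameDFA (Fin n) :=
    { step := fun q b => ⟨tStep n G q b, hlt q b⟩
      start := ⟨ent n G 1, h₁⟩
      accept := {q | q ∈ Finset.univ.filter (fun q : Fin n => TWinE n G q) ∨
        q ∈ Finset.univ.filter (fun q : Fin n => TWinA n G q)}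
      winE := Finset.univ.filter fun q => TWinE n G q
      winA := Finset.univ.filter fun q => TWinA n G q
      accept_eq := rfl }
  have hbit : ∀ x : ℕ, x < 2 → x = ind (x = 1) := fun x hx => by
    rw [ind_ite]
    split_ifs <;> omega
  refine ⟨D, h₀, rfl, fun _ _ => rfl, fun q => ?_, fun q => ?_⟩
  · rw [show (q ∈ D.winE) = TWinE n G q by simp [D]]
    exact hbit _ (h₃ _ (by omega))
  · rw [show (q ∈ D.winA) = TWinA n G q by simp [D]]
    exact hbit _ (h₃ _ (by omega))

theorem exists_represents (D : GameDFA (Fin n)) :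
    ∃ G < (n + 2) ^ (2 + (n + n + (n + n))), Represents G D := by
  have hn : 0 < n := D.start.pos
  -- The entries of the table of `D`, which become the digits of `G` in base `n + 2`.
  let e : ℕ → ℕ := fun j =>
    if j = 0 then n else if j = 1 then D.start else
      if hj : j < 2 + (n + n) then
        D.step ⟨(j - 2) / 2, by omega⟩ (decide ((j - 2) % 2 = 1))
      else if hj : j < 2 + (n + n + n) then ind (⟨j - (2 + (n + n)), by omega⟩ ∈ D.winE)
      else if hj : j < 2 + (n + n + (n + n)) then
        ind (⟨j - (2 + (n + n + n)), by omega⟩ ∈ D.winA)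
      else 0
  obtain ⟨G, hG, hd⟩ := exists_dig_eq (b := n + 2) (by omega) (2 + (n + n + (n + n))) e (by
    intro j _
    simp only [e]
    split_ifs
    · omega
    · have := D.start.2; omega
    · exact (Fin.is_lt _).trans (by omega)
    · exact (ind_le_one _).trans_lt (by omega)
    · exact (ind_le_one _).trans_lt (by omega))
  refine ⟨G, hG, ?_, ?_, fun q b => ?_, fun q => ?_, fun q => ?_⟩
  · exact hd 0 (by omega)
  · exact hd 1 (by omega)
  · have hb := b.toNat_le
    have hq := q.2
    refine (hd _ (by omega)).trans ?_
    simp only [e]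
    rw [if_neg (by omega), if_neg (by omega), dif_pos (by omega)]
    congr 2
    · congr 1
      omega
    · cases b <;> simp
      all_goals omega
  · have hq := q.2
    refine (hd _ (by omega)).trans ?_
    simp only [e]
    rw [if_neg (by omega), if_neg (by omega), dif_neg (by omega), dif_pos (by omega)]
    congr 2
    ext
    simp
    omega
  · have hq := q.2
    refine (hd _ (by omega)).trans ?_
    simp only [e]
    rw [if_neg (by omega), if_neg (by omega), dif_neg (by omega), dif_neg (by omega),
      dif_pos (by omega)]
    congr 2
    ext
    simp
    omega

end represents

/-! ### The decision procedure -/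

theorem length_le_encodeNats (l : List ℕ) : l.length ≤ (encodeNats l).length := by
  induction l with
  | nil => simp
  | cons k l ih =>
    have : encodeNats (k :: l) =
        (Computability.encodeNat k).map some ++ [none] ++ encodeNats l := by
      simp [encodeNats]
    rw [this]
    simp only [List.length_append, List.length_cons, List.length_nil]
    omega

theorem base_pow_le (n : ℕ) :
    (n + 2) ^ (2 + (n + n + (n + n))) ≤ 2 ^ (2 ^ (2 + (n + n + (n + n))) - 1) := by
  have h₁ : n + 2 ≤ 2 ^ (n + 1) := Nat.lt_two_pow_self
  have h₂ : 2 * n + 1 ≤ 2 ^ (2 * n) := Nat.lt_two_pow_self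
  have h₃ : (n + 1) * (2 + (n + n + (n + n))) < 2 ^ (2 + (n + n + (n + n))) := by
    have h₄ : 2 ^ (2 + (n + n + (n + n))) = 2 ^ n * 2 ^ (2 * n) * 2 ^ n * 4 := by ring
    have h₅ : n + 1 ≤ 2 ^ n := Nat.lt_two_pow_self
    have h₆ : (n + 1) * (2 * n + 1) ≤ 2 ^ n * 2 ^ (2 * n) := Nat.mul_le_mul h₅ h₂
    have h₇ : 1 ≤ 2 ^ n := Nat.one_le_two_pow
    have h₈ : 2 ^ n * 2 ^ (2 * n) * 1 ≤ 2 ^ n * 2 ^ (2 * n) * 2 ^ n := Nat.mul_le_mul_left _ h₇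
    have h₉ : 0 < 2 ^ n * 2 ^ (2 * n) := by positivity
    rw [h₄]
    nlinarith
  calc (n + 2) ^ (2 + (n + n + (n + n))) ≤ (2 ^ (n + 1)) ^ (2 + (n + n + (n + n))) :=
        Nat.pow_le_pow_left h₁ _
    _ = 2 ^ ((n + 1) * (2 + (n + n + (n + n)))) := (pow_mul _ _ _).symm
    _ ≤ _ := Nat.pow_le_pow_right two_pos (by omega)

/-- A property of game automata is decidable in EXPSPACE if it is decided in linear space from the
table and a number `N` that is doubly exponential in the number of states. -/
theorem inEXPSPACE_of_table {W : ∀ n, GameDFA (Fin n) → Prop} {T : ℕ → ℕ → ℕ → Prop}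
    (hT : ∀ {α : Type} [Ctx α] {n G N : α → ℕ}, Tame n → Tame G → Tame N →
      TameP fun x => T (n x) (G x) (N x))
    (hW : ∀ n G N (D : GameDFA (Fin n)), Represents G D → 2 ^ 2 ^ n ≤ N → (T n G N ↔ W n D)) :
    InEXPSPACE {x | ∃ (n : ℕ) (D : GameDFA (Fin n)), x = encodeGame D ∧ W n D} := by
  refine inEXPSPACE_of_tameP (P := fun X N => ∃ n < X + 1, ∃ G < N,
    wordNum (X + 1) n G (2 + (n + n + (n + n))) = X ∧ ValidTable n G ∧ T n G N) ?_ fun x => ?_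
  · have hX : Tame fun y : ℕ × ℕ => y.1 := Tame.var.fst
    refine .bex hX.succ <| .bex Tame.snd.fst <| .and (.eq (Tame.wordNum hX.fst.fst.succ
      Tame.snd.fst Tame.snd ?_) hX.fst.fst) <| .and (tameP_validTable Tame.snd.fst Tame.snd)
      (hT Tame.snd.fst Tame.snd Tame.snd.fst.fst)
    exact (Tame.const 2).add ((Tame.snd.fst.add Tame.snd.fst).add (Tame.snd.fst.add Tame.snd.fst))
  · have hbound : ∀ {n} (l : List ℕ), l.length = 2 + (n + n + (n + n)) → x = encodeNats l →
        2 ^ (2 + (n + n + (n + n))) ≤ val x + 1 := by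
      rintro n l hl rfl
      refine le_trans (Nat.pow_le_pow_right two_pos ?_) (two_pow_length_le _)
      rw [← hl]
      exact length_le_encodeNats l
    have hNle : ∀ {n}, 2 ^ (2 + (n + n + (n + n))) ≤ val x + 1 → 2 ^ 2 ^ n ≤ 2 ^ val x := by
      intro n h
      refine Nat.pow_le_pow_right two_pos ?_
      have h₁ : 2 ^ n < 2 ^ (2 + (n + n + (n + n))) := Nat.pow_lt_pow_right (by norm_num) (by omega)
      omega
    constructor
    · rintro ⟨n, D, hx, hD⟩
      obtain ⟨G, hG, hrep⟩ := exists_represents D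
      have hx' := hx.trans hrep.encode_eq
      have hb := hbound (n := n) _ (by simp) hx'
      have hn : 2 + (n + n + (n + n)) < 2 ^ (2 + (n + n + (n + n))) := Nat.lt_two_pow_self
      refine ⟨n, by omega, G, ?_, ?_, hrep.valid, (hW n G _ D hrep (hNle hb)).2 hD⟩
      · exact hG.trans_le ((base_pow_le n).trans
          (Nat.pow_le_pow_right two_pos (by omega)))
      · rw [wordNum_eq, ← hx']
        omega
    · rintro ⟨n, -, G, -, hword, hvalid, hD⟩
      obtain ⟨D, hrep⟩ := exists_represents_of_valid hvalid
      rw [wordNum_eq, ← hrep.encode_eq] at hword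
      have hx : x = encodeGame D := val_injective (by omega)
      exact ⟨n, D, hx, (hW n G _ D hrep
        (hNle (hbound (n := n) _ (by simp) (hx.trans hrep.encode_eq)))).1 hD⟩

end TDGCSolution

open TDGCSolution in
theorem mainTheorem3 (team : Team) :
    (∃ L : Language (Option Bool), InEXPSPACE L ∧
      ∀ (S : Type) [Finite S] (P : Policy S),
        (∀ p, P.mid p = ![1, 0] ∧ P.fin p = ![0, 0]) → TDGC team P = L) ∧
    (∀ i : Fin 2, ∃ L : Language (Option Bool), InEXPSPACE L ∧
      ∀ (S : Type) [Finite S] (P : Policy S),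
        (∀ p, 1 ≤ P.mid p i ∧ P.mid p (1 - i) = 0 ∧ P.fin p (1 - i) = 0) → TDGC team P = L) := by
  -- The first part is the case `i = 0` of the second.
  suffices h : ∀ i : Fin 2, ∃ L : Language (Option Bool), InEXPSPACE L ∧
      ∀ (S : Type) [Finite S] (P : Policy S),
        (∀ p, 1 ≤ P.mid p i ∧ P.mid p (1 - i) = 0 ∧ P.fin p (1 - i) = 0) → TDGC team P = L by
    refine ⟨?_, h⟩
    obtain ⟨L, hL, hP⟩ := h 0
    exact ⟨L, hL, fun S _ P hp => hP S P fun p => by simp [hp p]⟩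
  intro i
  cases team with
  | existential =>
    refine ⟨_, inEXPSPACE_of_table (W := fun n D => ∃ k, EWin D i k {D.start})
      (tameP_tExistential i) fun n G N D h hN => h.tExistential_iff i hN, fun S _ P hP => ?_⟩
    ext x
    refine exists_congr fun n => exists_congr fun D => and_congr_right fun _ => ?_
    exact ⟨eWin_of_existential fun p => (hP p).2,
      fun ⟨k, hk⟩ => existential_of_eWin D P hk fun p => (hP p).1⟩
  | universal =>
    refine ⟨_, inEXPSPACE_of_table (W := fun n D => ∃ k, UWin D k D.start)
      tameP_tUniversal fun n G N D h hN => h.tUniversal_iff (Nat.lt_two_pow_self.le.trans hN),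
      fun S _ P _ => ?_⟩
    ext x
    refine exists_congr fun n => exists_congr fun D => and_congr_right fun _ => ?_
    exact ⟨uWin_of_universal D P, fun ⟨k, hk⟩ => exists_universal_strategy D P hk⟩
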